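/- Let $l\ge 1$ and let $(p_1,\dots,p_l)$ be a Cunningham chain of odd primes, i.e. $p_i=2p_{i+1}+1$ for $1\le i\le l-1$. Let $n=p_1\cdots p_l$ and let $N\cong C_n$ be cyclic of order $n$. Write $\mathrm{Hol}(N)=N\rtimes\mathrm{Aut}(N)$, with elements $[\eta,\alpha]$ and product $[\eta,\alpha][\mu,\beta]=[\eta\,\alpha(\mu),\alpha\beta]$, acting on $N$ by $[\eta,\alpha]\cdot\mu=\eta\,\alpha(\mu)$; identify $\eta\in N$ with $[\eta,\mathrm{id}_N]$ and $\alpha\in\mathrm{Aut}(N)$ with $[1_N,\alpha]$. Write $p_l-1=2^xs$ with $s$ odd. Let $\sigma_i\in N$ have order $p_i$ $(1\le i\le l)$, and let $\alpha_i,\beta_i\in\mathrm{Aut}(N)$ fix $\sigma_j$ for every $j\ne i$, where $\alpha_i,\beta_i$ have orders $p_{i+1},2$ respectively for $1\le i\le l-1$, and $\alpha_l,\beta_l$ have orders $s,2^x$ respectively. Let $I$ range over the subsets of $\{2,\dots,l\}$ containing no two consecutive integers. For such an $I$ and a sequence $\mathbf t=(t_i)_{i\in I}$ with $1\le t_i\le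 p_i-1$, put $$J_{I,\mathbf t}=\left\langle \sigma_j,\ [\sigma_i,\alpha_{i-1}^{t_i}] \;\middle|\; i\in I,\ j\in\{1,\dots,l\}\setminus I\right\rangle\le\mathrm{Hol}(N),$$ and let $$S_I=\{i\in\{1,\dots,l\}\mid i\notin I,\ i+1\notin I\},\qquad A_I=\langle\alpha_i,\beta_j\mid i\in S_I,\ j\in\{1,\dots,l\}\setminus I\rangle\le\mathrm{Aut}(N).$$ **Proposition.** For a fixed $I$ and a fixed subgroup $A\le A_I$, the groups $J_{I,\mathbf t}A=J_{I,\mathbf t}\rtimes A$, for varying $\mathbf t$, are $\prod_{i\in I}(p_i-1)$ distinct subgroups of $\mathrm{Hol}(N)$ which are transitive on $N$, and they are all isomorphic to each other as permutation groups on $N$. There are no other isomorphisms among the transitive subgroups of $\mathrm{Hol}(N)$, even as abstract groups: if $M,M'\le\mathrm{Hol}(N)$ are transitive on $N$ and $M\cong M'$ as abstract groups, then $M=J_{I,\mathbf t}\rtimes A$ and $M'=J_{I,\mathbf t'}\rtimes A$ for one $I$, one $A\le A_I$, and some $\mathbf t,\mathbf t'$; and if $J_{I,\mathbf t}\rtimes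 A\cong J_{I',\mathbf t'}\rtimes A'$ as abstract groups, where $A\le A_I$ and $A'\le A_{I'}$, then $I=I'$ and $A=A'$. -/

import Mathlib

namespace Cunningham

/-- `(p 1, …, p l)` is a Cunningham chain of odd primes: `p i = 2 * p (i + 1) + 1`. Only the values
of `p` at the indices `1, …, l` matter. -/
def IsCunninghamChain (l : ℕ) (p : ℕ → ℕ) : Prop :=
  (∀ i ∈ Finset.Icc 1 l, (p i).Prime ∧ Odd (p i)) ∧
    ∀ i ∈ Finset.Ico 1 l, p i = 2 * p (i + 1) + 1

/-- The holomorph `N ⋊ Aut N`, with product `[η, α] [μ, β] = [η * α μ, α * β]`. -/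
abbrev Hol (N : Type*) [Group N] : Type _ :=
  SemidirectProduct N (MulAut N) (MonoidHom.id (MulAut N))

/-- The natural action of the holomorph on `N`: `[η, α]` sends `μ` to `η * α μ`. -/
instance holAction (N : Type*) [Group N] : MulAction (Hol N) N where
  smul g μ := g.left * g.right μ
  one_smul μ := by
    change (1 : Hol N).left * (1 : Hol N).right μ = μ
    simp
  mul_smul g h μ := by
    change (g * h).left * (g * h).right μ = g.left * g.right (h.left * h.right μ)
    simp [mul_assoc]

/-- Two subgroups of the holomorph are isomorphic as permutation groups on `N`: some bijection of
`N` carries the action of the first to the action of the second, along a group isomorphism. -/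
def PermIsomorphic {N : Type*} [Group N] (M M' : Subgroup (Hol N)) : Prop :=
  ∃ (e : M ≃* M') (f : N ≃ N), ∀ (m : M) (μ : N), f (m • μ) = e m • f μ

/-- The chosen elements of `N` and of `Aut N`: `σ i` has order `p i`; `α i` and `β i` are
automorphisms of `⟨σ i⟩`, extended to `N` by fixing the other `σ j`; for `i < l` they have orders
`p (i + 1)` and `2`, while `α l` and `β l` have orders `s` and `2 ^ x`, where `p l - 1 = 2 ^ x * s`
with `s` odd. -/
structure IsGenerators {N : Type*} [Group N] (l : ℕ) (p : ℕ → ℕ) (x s : ℕ)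
    (σ : ℕ → N) (α β : ℕ → MulAut N) : Prop where
  odd_s : Odd s
  two_pow_mul : p l - 1 = 2 ^ x * s
  order_sigma : ∀ i ∈ Finset.Icc 1 l, orderOf (σ i) = p i
  alpha_fix : ∀ i ∈ Finset.Icc 1 l, ∀ j ∈ Finset.Icc 1 l, i ≠ j → α i (σ j) = σ j
  beta_fix : ∀ i ∈ Finset.Icc 1 l, ∀ j ∈ Finset.Icc 1 l, i ≠ j → β i (σ j) = σ j
  order_alpha : ∀ i ∈ Finset.Ico 1 l, orderOf (α i) = p (i + 1)
  order_beta : ∀ i ∈ Finset.Ico 1 l, orderOf (β i) = 2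
  order_alpha_last : orderOf (α l) = s
  order_beta_last : orderOf (β l) = 2 ^ x

/-- The index sets: subsets of `{2, …, l}` without two consecutive integers. -/
def IsIndexSet (l : ℕ) (I : Finset ℕ) : Prop :=
  I ⊆ Finset.Icc 2 l ∧ ∀ i ∈ I, i + 1 ∉ I

/-- The exponent sequences `(t i)` for `i ∈ I`, with `1 ≤ t i ≤ p i - 1`. -/
def IsExponent (p : ℕ → ℕ) (I : Finset ℕ) (t : ℕ → ℕ) : Prop :=
  ∀ i ∈ I, 1 ≤ t i ∧ t i ≤ p i - 1

/-- `J_{I,t}`, generated by the `σ j` with `j ∉ I` and the `[σ i, α (i-1) ^ t i]` with `i ∈ I`. -/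
def J {N : Type*} [Group N] (l : ℕ) (σ : ℕ → N) (α : ℕ → MulAut N)
    (I : Finset ℕ) (t : ℕ → ℕ) : Subgroup (Hol N) :=
  Subgroup.closure
    ({g | ∃ j ∈ Finset.Icc 1 l \ I, g = SemidirectProduct.inl (σ j)} ∪
      {g | ∃ i ∈ I, g = ⟨σ i, α (i - 1) ^ t i⟩})

/-- The indices `i` in `{1, …, l}` such that neither `i` nor `i + 1` is in `I`. -/
def S (l : ℕ) (I : Finset ℕ) : Finset ℕ :=
  {i ∈ Finset.Icc 1 l | i ∉ I ∧ i + 1 ∉ I}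

/-- `A_I`, generated by the `α i` with `i ∈ S_I` and the `β j` with `j ∈ {1, …, l} \ I`. -/
def AI {N : Type*} [Group N] (l : ℕ) (α β : ℕ → MulAut N) (I : Finset ℕ) :
    Subgroup (MulAut N) :=
  Subgroup.closure
    ({a | ∃ i ∈ S l I, a = α i} ∪ {b | ∃ j ∈ Finset.Icc 1 l \ I, b = β j})

/-- A subgroup of `Aut N` inside the holomorph, as elements `[1, α]`. -/
def inHol {N : Type*} [Group N] (A : Subgroup (MulAut N)) : Subgroup (Hol N) :=
  A.map SemidirectProduct.inr

/-- The subgroup of the holomorph generated by `J_{I,t}` and `A`. -/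
def JA {N : Type*} [Group N] (l : ℕ) (σ : ℕ → N) (α : ℕ → MulAut N)
    (I : Finset ℕ) (t : ℕ → ℕ) (A : Subgroup (MulAut N)) : Subgroup (Hol N) :=
  J l σ α I t ⊔ inHol A

/-- The set of groups `J_{I,t} ⋊ A` for fixed `I` and `A` and varying `t`. -/
def family {N : Type*} [Group N] (l : ℕ) (p : ℕ → ℕ) (σ : ℕ → N) (α : ℕ → MulAut N)
    (I : Finset ℕ) (A : Subgroup (MulAut N)) : Set (Subgroup (Hol N)) :=
  {M | ∃ t : ℕ → ℕ, IsExponent p I t ∧ M = JA l σ α I t A}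

end Cunningham

/-! `N` is the product of the groups `⟨σ i⟩` of prime order, and `Aut N` is the product of the
cyclic groups `Aut ⟨σ i⟩`, of order `2 * p (i + 1)` for `i < l`, while `p l - 1` is prime to every
`p i`. Hence the automorphisms of order `p i` are powers of `α (i - 1)`, and there are none for `i =
1`.

Let `M` be transitive with `σ i ∉ M`. Commutators in `M` are translations in `M`, so they have no
`i`-th component; the action of `M` on that component is abelian and transitive, hence by
translations (`right_apply_of_inl_notMem`). A suitable power of an element `[σ i, γ]` of `M` is then
`[σ i, α (i - 1) ^ t]` with `t` prime to `p i`. It moves `σ (i - 1)`, which therefore lies in `M`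
(`exists_mk_mem`). So the set `I` of missing indices is an index set, `M` contains some `J_{I,t}`,
and as this is transitive, `M = J_{I,t} A` with `A = M ∩ Aut N ≤ A_I` (`exists_mem_family`).

Conversely, `J_{I,t}` is described by a homomorphism `ψ : N → Aut N`, which shows that `J_{I,t} A`
meets `Aut N` in `A` (`mem_JA`). Elements of `A_I` have order prime to `p i` for `i ∈ I`, so `t` is
determined by the group; conjugation by `Aut N` permutes the sequences `t` transitively
(`map_conj_JA`).

For abstract isomorphisms, the translations in `M` form the center times the commutator subgroup
(`center_sup_commutator`). An isomorphism thus respects translations and, through the conjugation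
action on them, automorphism parts (`right_map`); this recovers `I` and `A`. -/

namespace Cunningham

/-! ### Cyclic groups and elements of prime order. -/

section Cyclic

/-- In a finite cyclic group, an element whose order divides that of `a` is a power of `a`. -/
theorem mem_zpowers_of_pow_orderOf_eq_one {G : Type*} [Group G] [Finite G] [IsCyclic G] {a b : G}
    (h : b ^ orderOf a = 1) : b ∈ Subgroup.zpowers a := by
  classical
  have := Fintype.ofFinite G
  have hsub : (Subgroup.zpowers a : Set G).toFinset ⊆
      Finset.univ.filter fun c : G => c ^ orderOf a = 1 := by
    intro c hc
    rw [Set.mem_toFinset] at hc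
    obtain ⟨k, rfl⟩ := Subgroup.mem_zpowers_iff.1 hc
    rw [Finset.mem_filter, ← zpow_natCast, zpow_comm, zpow_natCast, pow_orderOf_eq_one, one_zpow]
    exact ⟨Finset.mem_univ _, rfl⟩
  have hcard : (Finset.univ.filter fun c : G => c ^ orderOf a = 1).card ≤
      ((Subgroup.zpowers a : Set G).toFinset).card := by
    refine (IsCyclic.card_pow_eq_one_le (orderOf_pos a)).trans ?_
    rw [Set.toFinset_card]
    exact (Fintype.card_zpowers).ge
  have hb : b ∈ Finset.univ.filter fun c : G => c ^ orderOf a = 1 := by simpa using h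
  rw [← Finset.eq_of_subset_of_card_le hsub hcard, Set.mem_toFinset] at hb
  exact hb

/-- A nontrivial power of an element of prime order generates the same subgroup. -/
theorem mem_zpowers_of_prime_orderOf {G : Type*} [Group G] {a b : G} (ha : (orderOf a).Prime)
    (hb : b ∈ Subgroup.zpowers a) (h1 : b ≠ 1) : a ∈ Subgroup.zpowers b := by
  obtain ⟨k, rfl⟩ := Subgroup.mem_zpowers_iff.1 hb
  have hk : ¬ (orderOf a : ℤ) ∣ k := fun hd => h1 (orderOf_dvd_iff_zpow_eq_one.1 hd)
  have hcop : IsCoprime (orderOf a : ℤ) k :=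
    (Prime.coprime_iff_not_dvd (Nat.prime_iff_prime_int.1 ha)).2 hk
  obtain ⟨u, v, huv⟩ := hcop
  refine Subgroup.mem_zpowers_iff.2 ⟨v, ?_⟩
  have h2 : a ^ (u * (orderOf a : ℤ) + v * k) = a := by rw [huv, zpow_one]
  rw [zpow_add, mul_comm u, zpow_mul, zpow_natCast, pow_orderOf_eq_one, one_zpow, one_mul,
    mul_comm, zpow_mul] at h2
  exact h2

theorem eq_one_of_pow_eq_one_of_coprime {G : Type*} [Group G] {a : G} {m n : ℕ}
    (hm : a ^ m = 1) (hn : a ^ n = 1) (h : m.Coprime n) : a = 1 := by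
  have : orderOf a ∣ 1 := h ▸ Nat.dvd_gcd (orderOf_dvd_of_pow_eq_one hm) (orderOf_dvd_of_pow_eq_one hn)
  exact orderOf_eq_one_iff.1 (Nat.dvd_one.1 this)

end Cyclic

/-! ### Automorphisms of a cyclic group as power maps. -/

section Aut

variable {N : Type*} [CommGroup N] [IsCyclic N]

/-- The automorphism group of a cyclic group is commutative. -/
theorem aut_mul_comm (γ δ : MulAut N) : γ * δ = δ * γ :=
  (IsCyclic.mulAutMulEquiv N).injective (by rw [map_mul, map_mul, mul_comm])

theorem aut_apply_eq_zpow (γ : MulAut N) : ∃ k : ℤ, ∀ ν : N, γ ν = ν ^ k :=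
  MonoidHom.map_cyclic γ.toMonoidHom

/-- The character through which `Aut N` acts on the subgroup generated by an element. -/
theorem exists_char (σ : N) : ∃ χ : MulAut N →* (ZMod (orderOf σ))ˣ,
    ∀ γ δ : MulAut N, χ γ = χ δ ↔ γ σ = δ σ := by
  choose k hk using fun γ : MulAut N => aut_apply_eq_zpow γ
  have key : ∀ (γ : MulAut N) (m : ℤ), γ σ = σ ^ m ↔ ((k γ : ℤ) : ZMod (orderOf σ)) = m := by
    intro γ m
    rw [hk, zpow_eq_zpow_iff_modEq, ZMod.intCast_eq_intCast_iff]
  let f : MulAut N →* ZMod (orderOf σ) :=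
    { toFun := fun γ => ((k γ : ℤ) : ZMod (orderOf σ))
      map_one' := by
        have := (key 1 1).1 (by simp)
        simpa using this
      map_mul' := fun γ δ => by
        have := (key (γ * δ) (k γ * k δ)).1 (by
          rw [MulAut.mul_apply, hk δ, map_zpow, hk γ, zpow_mul])
        simpa using this }
  refine ⟨f.toHomUnits, fun γ δ => ?_⟩
  rw [hk δ, key, ← Units.val_inj]
  rfl

/-- The character through which `Aut N` acts on the subgroup generated by `σ`. -/
noncomputable def char (σ : N) : MulAut N →* (ZMod (orderOf σ))ˣ := (exists_char σ).choose

theorem char_eq_iff {σ : N} {γ δ : MulAut N} : char σ γ = char σ δ ↔ γ σ = δ σ :=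
  (exists_char σ).choose_spec γ δ

theorem char_eq_one_iff {σ : N} {γ : MulAut N} : char σ γ = 1 ↔ γ σ = σ := by
  rw [← map_one (char σ), char_eq_iff, MulAut.one_apply]

theorem aut_pow_orderOf_sub_one {σ : N} (hσ : (orderOf σ).Prime) (γ : MulAut N) :
    (γ ^ (orderOf σ - 1)) σ = σ := by
  have := Fact.mk hσ
  rw [← char_eq_one_iff, map_pow, ZMod.units_pow_card_sub_one_eq_one]

theorem aut_apply_mem_zpowers (γ : MulAut N) (σ : N) : γ σ ∈ Subgroup.zpowers σ := by
  obtain ⟨k, hk⟩ := aut_apply_eq_zpow γ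
  exact Subgroup.mem_zpowers_iff.2 ⟨k, (hk σ).symm⟩

theorem aut_apply_mem (γ : MulAut N) (H : Subgroup N) {ν : N} (hν : ν ∈ H) : γ ν ∈ H :=
  (Subgroup.zpowers_le.2 hν) (aut_apply_mem_zpowers γ ν)

end Aut

/-! ### Computations in the holomorph. -/

section Hol

variable {N : Type*} [CommGroup N]

/-- The automorphisms fixing a given element. -/
def fixer (ν : N) : Subgroup (MulAut N) := MulAction.stabilizer (MulAut N) ν

theorem mem_fixer {ν : N} {γ : MulAut N} : γ ∈ fixer ν ↔ γ ν = ν := Iff.rfl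

theorem hol_smul (g : Hol N) (μ : N) : g • μ = g.left * g.right μ := rfl

/-- The translation part of `m` is the image of `1` under `m`, so only the orbit of `1` has to be
examined. -/
theorem isPretransitive_iff (M : Subgroup (Hol N)) :
    MulAction.IsPretransitive M N ↔ ∀ ν : N, ∃ m ∈ M, m.left = ν := by
  have key : ∀ m : M, m • (1 : N) = (m : Hol N).left := fun m => by
    change (m : Hol N).left * (m : Hol N).right 1 = _
    rw [map_one, mul_one]
  constructor
  · intro h ν
    obtain ⟨m, hm⟩ := h.exists_smul_eq 1 ν
    exact ⟨m, m.2, by rw [← key, hm]⟩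
  · intro h
    refine ⟨fun a b => ?_⟩
    obtain ⟨m, hm, rfl⟩ := h a
    obtain ⟨k, hk, rfl⟩ := h b
    refine ⟨⟨k, hk⟩ * (⟨m, hm⟩ : M)⁻¹, ?_⟩
    rw [← key ⟨m, hm⟩, ← key ⟨k, hk⟩, mul_smul, inv_smul_smul]

theorem mk_mul_mk (a b : N) (γ δ : MulAut N) :
    (⟨a, γ⟩ * ⟨b, δ⟩ : Hol N) = ⟨a * γ b, γ * δ⟩ := rfl

theorem mk_pow_of_fixed {ν : N} {γ : MulAut N} (h : γ ν = ν) (k : ℕ) :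
    (⟨ν, γ⟩ : Hol N) ^ k = ⟨ν ^ k, γ ^ k⟩ := by
  induction k with
  | zero => simp only [pow_zero]; rfl
  | succ k ih =>
    have h' : γ ^ k ∈ fixer ν := (fixer ν).pow_mem (mem_fixer.2 h) k
    rw [pow_succ, ih, mk_mul_mk, mem_fixer.1 h', ← pow_succ, ← pow_succ]

theorem inl_div_mem {M : Subgroup (Hol N)} {a b : N} {γ : MulAut N}
    (ha : (⟨a, γ⟩ : Hol N) ∈ M) (hb : (⟨b, γ⟩ : Hol N) ∈ M) :
    (SemidirectProduct.inl (a / b) : Hol N) ∈ M := by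
  have : (SemidirectProduct.inl (a / b) : Hol N) = ⟨a, γ⟩ * (⟨b, γ⟩ : Hol N)⁻¹ := by
    rw [eq_mul_inv_iff_mul_eq]
    change (⟨a / b, 1⟩ * ⟨b, γ⟩ : Hol N) = ⟨a, γ⟩
    rw [mk_mul_mk, MulAut.one_apply, div_mul_cancel, one_mul]
  rw [this]
  exact M.mul_mem ha (M.inv_mem hb)

/-- Two elements of the holomorph with the same translation part differ by an automorphism. -/
theorem inr_inv_mul_mem {M : Subgroup (Hol N)} {a : N} {γ δ : MulAut N}
    (hγ : (⟨a, γ⟩ : Hol N) ∈ M) (hδ : (⟨a, δ⟩ : Hol N) ∈ M) :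
    (SemidirectProduct.inr (γ⁻¹ * δ) : Hol N) ∈ M := by
  have : (SemidirectProduct.inr (γ⁻¹ * δ) : Hol N) = (⟨a, γ⟩ : Hol N)⁻¹ * ⟨a, δ⟩ := by
    rw [eq_inv_mul_iff_mul_eq]
    change (⟨a, γ⟩ * ⟨1, γ⁻¹ * δ⟩ : Hol N) = ⟨a, δ⟩
    rw [mk_mul_mk, map_one, mul_one, mul_inv_cancel_left]
  rw [this]
  exact M.mul_mem (M.inv_mem hγ) hδ

/-- Since `Aut N` is abelian, `g * h` and `h * g` have the same automorphism part and differ by a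
translation. -/
theorem commutator_mem [IsCyclic N] {M : Subgroup (Hol N)} {g h : Hol N} (hg : g ∈ M) (hh : h ∈ M) :
    (SemidirectProduct.inl ((g.left * g.right h.left) / (h.left * h.right g.left)) : Hol N) ∈ M := by
  have h1 := M.mul_mem hg hh
  have h2 := M.mul_mem hh hg
  refine inl_div_mem (γ := g.right * h.right) h1 ?_
  rw [aut_mul_comm]
  exact h2

end Hol

/-- The standing hypotheses: a Cunningham chain, a cyclic group of order the product of its terms,
and the chosen generators. -/
structure IsSystem {N : Type*} [CommGroup N] [IsCyclic N] (l : ℕ) (p : ℕ → ℕ) (x s : ℕ)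
    (σ : ℕ → N) (α β : ℕ → MulAut N) : Prop extends IsGenerators l p x s σ α β where
  chain : IsCunninghamChain l p
  card_eq : Nat.card N = ∏ i ∈ Finset.Icc 1 l, p i

namespace IsSystem

variable {N : Type*} [CommGroup N] [IsCyclic N] {l : ℕ} {p : ℕ → ℕ} {x s : ℕ}
  {σ : ℕ → N} {α β : ℕ → MulAut N}

/-! ### Coprimality along the chain. -/

section Arithmetic

theorem prime (h : IsSystem l p x s σ α β) {i : ℕ} (hi : i ∈ Finset.Icc 1 l) : (p i).Prime :=
  (h.chain.1 i hi).1

theorem odd (h : IsSystem l p x s σ α β) {i : ℕ} (hi : i ∈ Finset.Icc 1 l) : Odd (p i) :=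
  (h.chain.1 i hi).2

theorem sub_one_eq (h : IsSystem l p x s σ α β) {i : ℕ} (hi : i ∈ Finset.Ico 1 l) :
    p i - 1 = 2 * p (i + 1) := by
  rw [h.chain.2 i hi, Nat.add_sub_cancel]

theorem lt (h : IsSystem l p x s σ α β) {i j : ℕ} (hi : 1 ≤ i) (hij : i < j) (hj : j ≤ l) :
    p j < p i := by
  induction j, hij using Nat.le_induction with
  | base =>
    have := h.chain.2 i (by simp; omega)
    rw [Nat.succ_eq_add_one]
    omega
  | succ j hij ih =>
    have h1 := ih (by omega)
    have := h.chain.2 j (by simp; omega)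
    omega

theorem eq_of_prime_eq (h : IsSystem l p x s σ α β) {i j : ℕ} (hi : i ∈ Finset.Icc 1 l)
    (hj : j ∈ Finset.Icc 1 l) (hp : p i = p j) : i = j := by
  rw [Finset.mem_Icc] at hi hj
  rcases lt_trichotomy i j with hlt | rfl | hlt
  · have := h.lt hi.1 hlt hj.2; omega
  · rfl
  · have := h.lt hj.1 hlt hi.2; omega

theorem coprime (h : IsSystem l p x s σ α β) {i j : ℕ} (hi : i ∈ Finset.Icc 1 l)
    (hj : j ∈ Finset.Icc 1 l) (hij : i ≠ j) : (p i).Coprime (p j) :=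
  (Nat.coprime_primes (h.prime hi) (h.prime hj)).2 fun he => hij (h.eq_of_prime_eq hi hj he)

theorem coprime_two (h : IsSystem l p x s σ α β) {i : ℕ} (hi : i ∈ Finset.Icc 1 l) :
    Nat.Coprime 2 (p i) :=
  Nat.coprime_two_left.2 (h.odd hi)

theorem coprime_sub_one_last (h : IsSystem l p x s σ α β) {i : ℕ} (hi : i ∈ Finset.Icc 1 l) :
    (p l - 1).Coprime (p i) := by
  rw [Finset.mem_Icc] at hi
  have hl : l ∈ Finset.Icc 1 l := by rw [Finset.mem_Icc]; omega
  have hle : p l ≤ p i := by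
    rcases hi.2.eq_or_lt with rfl | hlt
    · rfl
    · exact (h.lt hi.1 hlt le_rfl).le
  have h2 := (h.prime hl).two_le
  exact (Nat.coprime_of_lt_prime (by omega) (by omega) (h.prime (Finset.mem_Icc.2 hi))).symm

/-- For `j < l` the only odd prime divisor of `p j - 1` is `p (j + 1)`, and `p l - 1` is smaller
than every prime of the chain. -/
theorem coprime_sub_one (h : IsSystem l p x s σ α β) {i j : ℕ} (hi : i ∈ Finset.Icc 1 l)
    (hj : j ∈ Finset.Icc 1 l) (hij : j + 1 ≠ i) : (p j - 1).Coprime (p i) := by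
  rw [Finset.mem_Icc] at hj
  rcases hj.2.eq_or_lt with rfl | hlt
  · exact h.coprime_sub_one_last hi
  · rw [h.sub_one_eq (Finset.mem_Ico.2 ⟨hj.1, hlt⟩)]
    exact (h.coprime_two hi).mul_left
      (h.coprime (Finset.mem_Icc.2 ⟨by omega, hlt⟩) hi hij)

end Arithmetic

/-! ### Primary decomposition of `N`. -/

section Translations

theorem finite (h : IsSystem l p x s σ α β) : Finite N := by
  refine Nat.finite_of_card_ne_zero ?_
  rw [h.card_eq]
  exact Finset.prod_ne_zero_iff.2 fun i hi => (h.prime hi).ne_zero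

theorem prime_orderOf (h : IsSystem l p x s σ α β) {i : ℕ} (hi : i ∈ Finset.Icc 1 l) :
    (orderOf (σ i)).Prime := by
  rw [h.order_sigma i hi]; exact h.prime hi

theorem sigma_pow (h : IsSystem l p x s σ α β) {i : ℕ} (hi : i ∈ Finset.Icc 1 l) :
    σ i ^ p i = 1 := by
  rw [← h.order_sigma i hi, pow_orderOf_eq_one]

theorem sigma_ne_one (h : IsSystem l p x s σ α β) {i : ℕ} (hi : i ∈ Finset.Icc 1 l) : σ i ≠ 1 :=
  fun h1 => (h.prime_orderOf hi).ne_one (orderOf_eq_one_iff.2 h1)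

theorem eq_top_of_sigma_mem (h : IsSystem l p x s σ α β) {H : Subgroup N}
    (hH : ∀ i ∈ Finset.Icc 1 l, σ i ∈ H) : H = ⊤ := by
  have := h.finite
  refine Subgroup.eq_top_of_le_card H (Nat.le_of_dvd Nat.card_pos ?_)
  rw [h.card_eq]
  refine Finset.prod_dvd_of_isRelPrime
    (fun i hi j hj hij => Nat.coprime_iff_isRelPrime.1 (h.coprime hi hj hij)) fun i hi => ?_
  rw [← h.order_sigma i hi]
  exact Subgroup.orderOf_dvd_natCard _ (hH i hi)

theorem hom_ext (h : IsSystem l p x s σ α β) {Q : Type*} [Monoid Q] {f g : N →* Q}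
    (hfg : ∀ i ∈ Finset.Icc 1 l, f (σ i) = g (σ i)) : f = g := by
  have := h.eq_top_of_sigma_mem (H := f.eqLocus g) hfg
  ext ν
  exact (this ▸ Subgroup.mem_top ν : ν ∈ f.eqLocus g)

theorem aut_ext (h : IsSystem l p x s σ α β) {γ δ : MulAut N}
    (hγδ : ∀ i ∈ Finset.Icc 1 l, γ (σ i) = δ (σ i)) : γ = δ := by
  have := h.hom_ext (f := γ.toMonoidHom) (g := δ.toMonoidHom) hγδ
  ext ν
  exact DFunLike.congr_fun this ν

/-- Exponents whose power maps are the projections of `N` to its primary components. -/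
theorem exists_idempotent (h : IsSystem l p x s σ α β) (j : ℕ) (hj : j ∈ Finset.Icc 1 l) :
    ∃ m : ℕ, m ≡ 1 [MOD p j] ∧ ∀ i ∈ Finset.Icc 1 l, i ≠ j → p i ∣ m := by
  have hco : (p j).Coprime (∏ i ∈ (Finset.Icc 1 l).erase j, p i) :=
    Nat.Coprime.prod_right fun i hi =>
      h.coprime hj (Finset.mem_of_mem_erase hi) (Finset.ne_of_mem_erase hi).symm
  obtain ⟨m, hm1, hm2⟩ := Nat.chineseRemainder hco 1 0
  refine ⟨m, hm1, fun i hi hij => ?_⟩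
  exact (Finset.dvd_prod_of_mem p (Finset.mem_erase.2 ⟨hij, hi⟩)).trans
    ((Nat.modEq_zero_iff_dvd).1 hm2)

/-- The exponent whose power map is the projection of `N` to its `j`-th primary component. -/
noncomputable def idem (h : IsSystem l p x s σ α β) (j : ℕ) : ℕ :=
  if hj : j ∈ Finset.Icc 1 l then (h.exists_idempotent j hj).choose else 0

theorem pow_idem_self (h : IsSystem l p x s σ α β) {j : ℕ} (hj : j ∈ Finset.Icc 1 l) {Q : Type*}
    [Monoid Q] {y : Q} (hy : y ^ p j = 1) : y ^ h.idem j = y := by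
  rw [idem, dif_pos hj]
  have := (h.exists_idempotent j hj).choose_spec.1
  rw [pow_eq_pow_mod _ hy, this, ← pow_eq_pow_mod _ hy, pow_one]

theorem pow_idem_of_ne (h : IsSystem l p x s σ α β) {i j : ℕ} (hi : i ∈ Finset.Icc 1 l)
    (hj : j ∈ Finset.Icc 1 l) (hij : i ≠ j) {Q : Type*} [Monoid Q] {y : Q} (hy : y ^ p i = 1) :
    y ^ h.idem j = 1 := by
  rw [idem, dif_pos hj]
  obtain ⟨c, hc⟩ := (h.exists_idempotent j hj).choose_spec.2 i hi hij
  rw [hc, pow_mul, hy, one_pow]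

theorem prod_pow_idem (h : IsSystem l p x s σ α β) {Q : Type*} [CommMonoid Q] {y : ℕ → Q}
    (hy : ∀ i ∈ Finset.Icc 1 l, y i ^ p i = 1) {j : ℕ} (hj : j ∈ Finset.Icc 1 l) :
    (∏ i ∈ Finset.Icc 1 l, y i) ^ h.idem j = y j := by
  rw [← Finset.prod_pow, Finset.prod_eq_single j
    (fun i hi hij => h.pow_idem_of_ne hi hj hij (hy i hi)) (fun hn => (hn hj).elim)]
  exact h.pow_idem_self hj (hy j hj)

theorem pow_idem_mem (h : IsSystem l p x s σ α β) {j : ℕ} (hj : j ∈ Finset.Icc 1 l) (ν : N) :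
    ν ^ h.idem j ∈ Subgroup.zpowers (σ j) := by
  have : (Subgroup.zpowers (σ j)).comap (powMonoidHom (h.idem j)) = ⊤ := by
    refine h.eq_top_of_sigma_mem fun i hi => ?_
    rw [Subgroup.mem_comap, powMonoidHom_apply]
    by_cases hij : i = j
    · subst hij
      exact Subgroup.pow_mem _ (Subgroup.mem_zpowers _) _
    · rw [h.pow_idem_of_ne hi hj hij (h.sigma_pow hi)]
      exact Subgroup.one_mem _
  exact (this ▸ Subgroup.mem_top ν : ν ∈ (Subgroup.zpowers (σ j)).comap _)

theorem prod_idem (h : IsSystem l p x s σ α β) (ν : N) :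
    ∏ j ∈ Finset.Icc 1 l, ν ^ h.idem j = ν := by
  have : (∏ j ∈ Finset.Icc 1 l, powMonoidHom (h.idem j) : N →* N) = MonoidHom.id N := by
    refine h.hom_ext fun i hi => ?_
    rw [MonoidHom.finsetProd_apply, Finset.prod_eq_single i]
    · exact h.pow_idem_self hi (h.sigma_pow hi)
    · exact fun j hj hji => h.pow_idem_of_ne hi hj hji.symm (h.sigma_pow hi)
    · exact fun hn => (hn hi).elim
  have h2 := DFunLike.congr_fun this ν
  rw [MonoidHom.finsetProd_apply] at h2
  exact h2

/-- A nontrivial `j`-th component of `ν` would generate `⟨σ j⟩` and be a power of `ν`, putting `σ j`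
into `H`. -/
theorem pow_idem_eq_one (h : IsSystem l p x s σ α β) {H : Subgroup N} {j : ℕ}
    (hj : j ∈ Finset.Icc 1 l) (hH : σ j ∉ H) {ν : N} (hν : ν ∈ H) : ν ^ h.idem j = 1 := by
  by_contra h1
  have h2 := mem_zpowers_of_prime_orderOf (h.prime_orderOf hj) (h.pow_idem_mem hj ν) h1
  exact hH (Subgroup.zpowers_le.2 (H.pow_mem hν _) h2)

/-- A subgroup of `N` is generated by the `σ j` that it contains. -/
theorem le_of_sigma_mem (h : IsSystem l p x s σ α β) {H K : Subgroup N}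
    (hHK : ∀ j ∈ Finset.Icc 1 l, σ j ∈ H → σ j ∈ K) : H ≤ K := by
  intro ν hν
  rw [← h.prod_idem ν]
  refine Subgroup.prod_mem _ fun j hj => ?_
  by_cases hσ : σ j ∈ H
  · exact Subgroup.zpowers_le.2 (hHK j hj hσ) (h.pow_idem_mem hj ν)
  · rw [h.pow_idem_eq_one hj hσ hν]
    exact K.one_mem

/-- Homomorphisms out of `N` with prescribed values at the `σ j`. -/
theorem exists_hom (h : IsSystem l p x s σ α β) {Q : Type*} [CommGroup Q] (y : ℕ → Q)
    (hy : ∀ i ∈ Finset.Icc 1 l, y i ^ p i = 1) :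
    ∃ ψ : N →* Q, ∀ i ∈ Finset.Icc 1 l, ψ (σ i) = y i := by
  have hσ := fun j => h.prod_pow_idem (y := σ) (j := j) fun _ => h.sigma_pow
  -- The product of all `σ i` generates `N`, since the idempotent exponents recover each factor; the
  -- homomorphism sends it to the product of the `y i`.
  have htop : Subgroup.zpowers (∏ i ∈ Finset.Icc 1 l, σ i) = ⊤ :=
    h.eq_top_of_sigma_mem fun j hj => by
      have h2 := Subgroup.pow_mem _
        (Subgroup.mem_zpowers (∏ i ∈ Finset.Icc 1 l, σ i)) (h.idem j)
      rwa [hσ j hj] at h2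
  have hord : orderOf (∏ i ∈ Finset.Icc 1 l, y i) ∣ orderOf (∏ i ∈ Finset.Icc 1 l, σ i) := by
    rw [orderOf_eq_card_of_zpowers_eq_top htop, h.card_eq]
    refine orderOf_dvd_of_pow_eq_one ?_
    rw [← Finset.prod_pow]
    refine Finset.prod_eq_one fun i hi => ?_
    obtain ⟨c, hc⟩ := Finset.dvd_prod_of_mem p hi
    rw [hc, pow_mul, hy i hi, one_pow]
  refine ⟨monoidHomOfForallMemZpowers (fun ν => htop ▸ Subgroup.mem_top ν) hord, fun i hi => ?_⟩
  have h2 := congrArg (monoidHomOfForallMemZpowers (fun ν => htop ▸ Subgroup.mem_top ν) hord)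
    (hσ i hi)
  rw [map_pow, monoidHomOfForallMemZpowers_apply_gen, h.prod_pow_idem hy hi] at h2
  exact h2.symm

end Translations

/-! ### Primary decomposition of `Aut N`. -/

section Automorphisms

theorem orderOf_char (h : IsSystem l p x s σ α β) {j : ℕ} {γ : MulAut N}
    (hγ : ∀ i ∈ Finset.Icc 1 l, j ≠ i → γ (σ i) = σ i) : orderOf (char (σ j) γ) = orderOf γ := by
  refine orderOf_eq_orderOf_iff.2 fun n => ?_
  rw [← map_pow, char_eq_one_iff]
  refine ⟨fun h1 => h.aut_ext fun i hi => ?_, fun h1 => by rw [h1, MulAut.one_apply]⟩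
  by_cases hij : j = i
  · rw [← hij, h1, MulAut.one_apply]
  · exact (fixer (σ i)).pow_mem (mem_fixer.2 (hγ i hi hij)) n

/-- This lets the last index, with orders `s` and `2 ^ x`, be treated like the others. -/
theorem index_cases (h : IsSystem l p x s σ α β) {j : ℕ} (hj : j ∈ Finset.Icc 1 l) :
    orderOf (α j) * orderOf (β j) = p j - 1 ∧ (orderOf (α j)).Coprime (orderOf (β j)) := by
  rw [Finset.mem_Icc] at hj
  rcases hj.2.eq_or_lt with rfl | hlt
  · rw [h.order_alpha_last, h.order_beta_last, h.two_pow_mul, mul_comm]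
    exact ⟨rfl, Nat.Coprime.pow_right _ (Nat.coprime_two_right.2 h.odd_s)⟩
  · have hj' := Finset.mem_Ico.2 ⟨hj.1, hlt⟩
    rw [h.order_alpha j hj', h.order_beta j hj', h.sub_one_eq hj', mul_comm]
    exact ⟨rfl, (h.coprime_two (Finset.mem_Icc.2 ⟨by omega, hlt⟩)).symm⟩

theorem isCyclic_units (h : IsSystem l p x s σ α β) {j : ℕ} (hj : j ∈ Finset.Icc 1 l) :
    IsCyclic (ZMod (orderOf (σ j)))ˣ :=
  ZMod.isCyclic_units_prime (h.prime_orderOf hj)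

/-- The automorphisms `α j` and `β j` generate the automorphisms of the `j`-th component. -/
theorem exists_mem_closure (h : IsSystem l p x s σ α β) {j : ℕ} (hj : j ∈ Finset.Icc 1 l)
    (u : (ZMod (orderOf (σ j)))ˣ) :
    ∃ γ ∈ Subgroup.closure {α j, β j}, char (σ j) γ = u := by
  have := Fact.mk (h.prime_orderOf hj)
  suffices hs : (Subgroup.closure {α j, β j}).map (char (σ j)) = ⊤ by
    have hu : u ∈ (Subgroup.closure {α j, β j}).map (char (σ j)) := hs ▸ Subgroup.mem_top u
    exact Subgroup.mem_map.1 hu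
  refine Subgroup.eq_top_of_le_card _ (Nat.le_of_dvd Nat.card_pos ?_)
  have hcard : Nat.card (ZMod (orderOf (σ j)))ˣ = orderOf (α j) * orderOf (β j) := by
    rw [Nat.card_eq_fintype_card, ZMod.card_units, h.order_sigma j hj, (h.index_cases hj).1]
  rw [hcard]
  refine (h.index_cases hj).2.mul_dvd_of_dvd_of_dvd ?_ ?_
  · rw [← h.orderOf_char (h.alpha_fix j hj)]
    exact Subgroup.orderOf_dvd_natCard _
      (Subgroup.mem_map_of_mem _ (Subgroup.subset_closure (by simp)))
  · rw [← h.orderOf_char (h.beta_fix j hj)]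
    exact Subgroup.orderOf_dvd_natCard _
      (Subgroup.mem_map_of_mem _ (Subgroup.subset_closure (by simp)))

theorem closure_fix (h : IsSystem l p x s σ α β) {j : ℕ} (hj : j ∈ Finset.Icc 1 l) {i : ℕ}
    (hi : i ∈ Finset.Icc 1 l) (hij : j ≠ i) : Subgroup.closure {α j, β j} ≤ fixer (σ i) := by
  rw [Subgroup.closure_le]
  rintro γ (rfl | rfl)
  · exact h.alpha_fix j hj i hi hij
  · exact h.beta_fix j hj i hi hij

/-- An automorphism which acts on the `j`-th component like the elements of a subgroup `B` do, for
each `j`, lies in `B`, provided that these elements act on the `j`-th component only. -/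
theorem mem_of_components (h : IsSystem l p x s σ α β) {B : Subgroup (MulAut N)} (γ : MulAut N)
    (hB : ∀ j ∈ Finset.Icc 1 l, ∃ δ ∈ B, δ (σ j) = γ (σ j) ∧
      ∀ i ∈ Finset.Icc 1 l, j ≠ i → δ (σ i) = σ i) : γ ∈ B := by
  have key : ∀ F ⊆ Finset.Icc 1 l, ∃ δ ∈ B, (∀ j ∈ F, δ (σ j) = γ (σ j)) ∧
      ∀ i ∈ Finset.Icc 1 l, i ∉ F → δ (σ i) = σ i := by
    intro F
    induction F using Finset.induction_on with
    | empty => exact fun _ => ⟨1, B.one_mem, by simp, by simp⟩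
    | insert j F hjF ih =>
      intro hF
      rw [Finset.insert_subset_iff] at hF
      obtain ⟨δ, hδ, h1, h2⟩ := ih hF.2
      obtain ⟨ε, hε, h3, h4⟩ := hB j hF.1
      refine ⟨δ * ε, B.mul_mem hδ hε, fun i hi => ?_, fun i hi hiF => ?_⟩
      · rcases Finset.mem_insert.1 hi with rfl | hi
        · rw [aut_mul_comm, MulAut.mul_apply, h2 i hF.1 hjF, h3]
        · rw [MulAut.mul_apply, h4 i (hF.2 hi) (fun he => hjF (he ▸ hi)), h1 i hi]
      · rw [Finset.mem_insert, not_or] at hiF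
        rw [MulAut.mul_apply, h4 i hi (Ne.symm hiF.1), h2 i hi hiF.2]
  obtain ⟨δ, hδ, h1, -⟩ := key _ subset_rfl
  rwa [h.aut_ext (γ := γ) (δ := δ) fun i hi => (h1 i hi).symm]

/-- Automorphisms with prescribed values at the `σ j`. -/
theorem exists_aut (h : IsSystem l p x s σ α β) (k : ℕ → ℕ)
    (hk : ∀ j ∈ Finset.Icc 1 l, (k j).Coprime (p j)) :
    ∃ γ : MulAut N, ∀ j ∈ Finset.Icc 1 l, γ (σ j) = σ j ^ k j := by
  have := h.finite
  obtain ⟨f, hf⟩ := h.exists_hom (fun j => σ j ^ k j) fun i hi => by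
    rw [← pow_mul, mul_comm, pow_mul, h.sigma_pow hi, one_pow]
  have hr : f.range = ⊤ := h.eq_top_of_sigma_mem fun j hj => by
    have h1 : σ j ^ k j ∈ f.range := ⟨σ j, hf j hj⟩
    refine Subgroup.zpowers_le.2 h1 (mem_zpowers_of_prime_orderOf (h.prime_orderOf hj)
      (Subgroup.pow_mem _ (Subgroup.mem_zpowers _) _) fun h2 => h.sigma_ne_one hj ?_)
    exact eq_one_of_pow_eq_one_of_coprime h2 (h.sigma_pow hj) (hk j hj)
  have hs : Function.Surjective f := MonoidHom.range_eq_top.1 hr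
  exact ⟨MulEquiv.ofBijective f ⟨Finite.injective_iff_surjective.2 hs, hs⟩, hf⟩

/-- For each index `i` some power map on `Aut N`, with exponent prime to `p i`, projects to the
`p i`-primary part, which lives on the component with index `i - 1`. -/
theorem exists_exponent (h : IsSystem l p x s σ α β) {i : ℕ} (hi : i ∈ Finset.Icc 1 l) :
    ∃ E : ℕ, E.Coprime (p i) ∧ ∀ γ : MulAut N,
      (∀ j ∈ Finset.Icc 1 l, j + 1 ≠ i → (γ ^ E) (σ j) = σ j) ∧
      (∀ j ∈ Finset.Ico 1 l, j + 1 = i → γ ^ E ∈ Subgroup.zpowers (α j)) := by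
  -- The factors `p j - 1` kill all components except the one with `j + 1 = i`; there the group has
  -- order `2 * p i`, and the factor `2` leaves only its `p i`-part.
  have hE : ((∏ j ∈ (Finset.Icc 1 l).filter (fun j => j + 1 ≠ i), (p j - 1)) * 2).Coprime (p i) := by
    refine Nat.Coprime.mul_left (Nat.Coprime.prod_left fun j hj => ?_) (h.coprime_two hi)
    rw [Finset.mem_filter] at hj
    exact h.coprime_sub_one hi hj.1 hj.2
  refine ⟨_, hE, fun γ => ?_⟩
  have h1 : ∀ j ∈ Finset.Icc 1 l, j + 1 ≠ i →
      (γ ^ ((∏ j ∈ (Finset.Icc 1 l).filter (fun j => j + 1 ≠ i), (p j - 1)) * 2)) (σ j) = σ j := by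
    intro j hj hji
    obtain ⟨c, hc⟩ := (Finset.dvd_prod_of_mem (fun j => p j - 1)
      ((Finset.mem_filter (p := fun j => j + 1 ≠ i)).2 ⟨hj, hji⟩)).mul_right 2
    rw [hc, pow_mul, ← h.order_sigma j hj]
    exact (fixer (σ j)).pow_mem (mem_fixer.2 (aut_pow_orderOf_sub_one (h.prime_orderOf hj) γ)) c
  refine ⟨h1, ?_⟩
  rintro j hj rfl
  have hj' : j ∈ Finset.Icc 1 l := Finset.Ico_subset_Icc_self hj
  have := Fact.mk (h.prime_orderOf hj')
  have := h.isCyclic_units hj'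
  generalize ∏ i ∈ (Finset.Icc 1 l).filter (fun i => i + 1 ≠ j + 1), (p i - 1) = c at h1 ⊢
  have h2 : char (σ j) (γ ^ (c * 2)) ∈ Subgroup.zpowers (char (σ j) (α j)) := by
    refine mem_zpowers_of_pow_orderOf_eq_one ?_
    rw [h.orderOf_char (h.alpha_fix j hj'), h.order_alpha j hj, ← map_pow, ← pow_mul,
      char_eq_one_iff, mul_assoc, ← h.sub_one_eq hj, mul_comm, pow_mul, ← h.order_sigma j hj']
    exact (fixer (σ j)).pow_mem (mem_fixer.2 (aut_pow_orderOf_sub_one (h.prime_orderOf hj') γ)) c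
  obtain ⟨k, hk⟩ := Subgroup.mem_zpowers_iff.1 h2
  refine Subgroup.mem_zpowers_iff.2 ⟨k, h.aut_ext fun i hi => ?_⟩
  by_cases hij : j = i
  · subst hij
    rw [← char_eq_iff, map_zpow, hk]
  · rw [h1 i hi (by omega)]
    exact (fixer (σ i)).zpow_mem (mem_fixer.2 (h.alpha_fix j hj' i hi hij)) k

end Automorphisms

end IsSystem

/-! ### Structure of the groups `J_{I,t} A`. -/

theorem IsIndexSet.mem_Icc {l : ℕ} {I : Finset ℕ} (hI : IsIndexSet l I) {i : ℕ} (hi : i ∈ I) :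
    i ∈ Finset.Icc 1 l := by
  have := Finset.mem_Icc.1 (hI.1 hi)
  exact Finset.mem_Icc.2 ⟨by omega, this.2⟩

theorem IsIndexSet.exists_pred {l : ℕ} {I : Finset ℕ} (hI : IsIndexSet l I) {i : ℕ} (hi : i ∈ I) :
    ∃ j ∈ Finset.Ico 1 l, i = j + 1 ∧ j ∉ I := by
  have := Finset.mem_Icc.1 (hI.1 hi)
  obtain ⟨j, rfl⟩ : ∃ j, i = j + 1 := ⟨i - 1, by omega⟩
  exact ⟨j, Finset.mem_Ico.2 ⟨by omega, by omega⟩, rfl, fun hj => hI.2 j hj hi⟩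

theorem aut_inv_mul_mul {N : Type*} [CommGroup N] [IsCyclic N] (a b c d : MulAut N) :
    (a * b)⁻¹ * (c * d) = (a⁻¹ * c) * (b⁻¹ * d) := by
  rw [mul_inv_rev, aut_mul_comm b⁻¹, mul_assoc, ← mul_assoc b⁻¹, aut_mul_comm b⁻¹ c, mul_assoc c,
    mul_assoc]

section

variable {N : Type*} [CommGroup N] {l : ℕ} {σ : ℕ → N} {α : ℕ → MulAut N} {I : Finset ℕ}
  {t : ℕ → ℕ} {A : Subgroup (MulAut N)}

theorem J_le_JA : J l σ α I t ≤ JA l σ α I t A := le_sup_left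

theorem inl_mem_J {j : ℕ} (hj : j ∈ Finset.Icc 1 l \ I) :
    (SemidirectProduct.inl (σ j) : Hol N) ∈ J l σ α I t :=
  Subgroup.subset_closure (Or.inl ⟨j, hj, rfl⟩)

theorem mk_mem_J {i : ℕ} (hi : i ∈ I) : (⟨σ i, α (i - 1) ^ t i⟩ : Hol N) ∈ J l σ α I t :=
  Subgroup.subset_closure (Or.inr ⟨i, hi, rfl⟩)

end

namespace IsSystem

variable {N : Type*} [CommGroup N] [IsCyclic N] {l : ℕ} {p : ℕ → ℕ} {x s : ℕ}
  {σ : ℕ → N} {α β : ℕ → MulAut N} {I : Finset ℕ} {t : ℕ → ℕ} {A : Subgroup (MulAut N)}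

theorem AI_le_fixer (h : IsSystem l p x s σ α β) {i : ℕ} (hi : i ∈ I) (hil : i ∈ Finset.Icc 1 l) :
    AI l α β I ≤ fixer (σ i) := by
  rw [AI, Subgroup.closure_le]
  rintro γ (⟨j, hj, rfl⟩ | ⟨j, hj, rfl⟩)
  · rw [S, Finset.mem_filter] at hj
    exact h.alpha_fix j hj.1 i hil fun he => hj.2.1 (he ▸ hi)
  · rw [Finset.mem_sdiff] at hj
    exact h.beta_fix j hj.1 i hil fun he => hj.2 (he ▸ hi)

/-- Among the `α j` and `β j`, only `α (i - 1)` can have order divisible by `p i`, and `i ∈ I`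
excludes `i - 1` from `S l I`. The automorphism `β (i - 1)` may occur, but has order `2`. -/
theorem coprime_orderOf_of_mem_AI (h : IsSystem l p x s σ α β) {i : ℕ} (hi : i ∈ I)
    (hil : i ∈ Finset.Icc 1 l) {γ : MulAut N} (hγ : γ ∈ AI l α β I) :
    (orderOf γ).Coprime (p i) := by
  have hdvd : ∀ j ∈ Finset.Icc 1 l, j + 1 ≠ i →
      (orderOf (α j)).Coprime (p i) ∧ (orderOf (β j)).Coprime (p i) := fun j hj hji => by
    have h1 := h.coprime_sub_one hil hj hji
    rw [← (h.index_cases hj).1] at h1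
    exact ⟨h1.coprime_mul_right, h1.coprime_mul_left⟩
  rw [AI] at hγ
  induction hγ using Subgroup.closure_induction with
  | mem γ hγ =>
    rcases hγ with ⟨j, hj, rfl⟩ | ⟨j, hj, rfl⟩
    · rw [S, Finset.mem_filter] at hj
      exact (hdvd j hj.1 fun he => hj.2.2 (he ▸ hi)).1
    · rw [Finset.mem_sdiff] at hj
      by_cases hji : j + 1 = i
      · have h1 := Finset.mem_Icc.1 hj.1
        have h2 := Finset.mem_Icc.1 hil
        rw [h.order_beta j (Finset.mem_Ico.2 ⟨h1.1, by omega⟩)]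
        exact h.coprime_two hil
      · exact (hdvd j hj.1 hji).2
  | one => rw [orderOf_one]; exact Nat.coprime_one_left _
  | mul γ δ _ _ hγ hδ =>
    exact (hγ.mul_left hδ).coprime_dvd_left (Commute.orderOf_mul_dvd_mul_orderOf (aut_mul_comm γ δ))
  | inv γ _ hγ => rwa [orderOf_inv]

theorem alpha_pow_eq_one_iff (h : IsSystem l p x s σ α β) {j : ℕ} (hj : j ∈ Finset.Ico 1 l)
    {n : ℕ} : α j ^ n = 1 ↔ p (j + 1) ∣ n := by
  rw [← orderOf_dvd_iff_pow_eq_one, h.order_alpha j hj]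

theorem alpha_pow_ne_one (h : IsSystem l p x s σ α β) (hI : IsIndexSet l I)
    (ht : IsExponent p I t) {i : ℕ} (hi : i ∈ I) : α (i - 1) ^ t i ≠ 1 := by
  obtain ⟨j, hj, rfl, -⟩ := hI.exists_pred hi
  rw [Nat.add_sub_cancel]
  intro h1
  have h2 := Nat.le_of_dvd (ht _ hi).1 ((h.alpha_pow_eq_one_iff hj).1 h1)
  have h3 := (h.prime (hI.mem_Icc hi)).pos
  have h4 := (ht _ hi).2
  omega

theorem alpha_pred_fix (h : IsSystem l p x s σ α β) (hI : IsIndexSet l I) {i k : ℕ} (hi : i ∈ I)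
    (hk : k ∈ I) (n : ℕ) : (α (i - 1) ^ n) (σ k) = σ k := by
  obtain ⟨j, hj, rfl, hjI⟩ := hI.exists_pred hi
  exact (fixer (σ k)).pow_mem (h.alpha_fix j (Finset.Ico_subset_Icc_self hj) k (hI.mem_Icc hk)
    fun he => hjI (he ▸ hk)) n

/-- The homomorphism `N → Aut N` describing `J_{I,t}` as a set of pairs `[η, ψ η]`. -/
theorem exists_twist (h : IsSystem l p x s σ α β) (hI : IsIndexSet l I) (t : ℕ → ℕ) :
    ∃ ψ : N →* MulAut N, (∀ i ∈ I, ψ (σ i) = α (i - 1) ^ t i) ∧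
      ∀ j ∈ Finset.Icc 1 l \ I, ψ (σ j) = 1 := by
  let _ : CommGroup (MulAut N) :=
    { (inferInstance : Group (MulAut N)) with mul_comm := aut_mul_comm }
  obtain ⟨ψ, hψ⟩ := h.exists_hom (fun i => if i ∈ I then α (i - 1) ^ t i else 1) fun i _ => by
    by_cases hi : i ∈ I
    · obtain ⟨j, hj, rfl, -⟩ := hI.exists_pred hi
      rw [if_pos hi, Nat.add_sub_cancel, ← pow_mul, mul_comm, pow_mul,
        (h.alpha_pow_eq_one_iff hj).2 dvd_rfl, one_pow]
    · rw [if_neg hi, one_pow]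
  refine ⟨ψ, fun i hi => ?_, fun j hj => ?_⟩
  · rw [hψ i (hI.mem_Icc hi), if_pos hi]
  · rw [Finset.mem_sdiff] at hj
    rw [hψ j hj.1, if_neg hj.2]

/-- `ψ` sees only the components with index in `I`, where `γ` is trivial. -/
theorem twist_apply (h : IsSystem l p x s σ α β) {ψ : N →* MulAut N}
    (hψ : ∀ j ∈ Finset.Icc 1 l \ I, ψ (σ j) = 1) {γ : MulAut N} (hγ : ∀ i ∈ I, γ (σ i) = σ i)
    (ν : N) : ψ (γ ν) = ψ ν := by
  have : ψ.comp γ.toMonoidHom = ψ := by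
    refine h.hom_ext fun j hj => ?_
    change ψ (γ (σ j)) = ψ (σ j)
    by_cases hjI : j ∈ I
    · rw [hγ j hjI]
    · obtain ⟨k, hk⟩ := Subgroup.mem_zpowers_iff.1 (aut_apply_mem_zpowers γ (σ j))
      rw [← hk, map_zpow, hψ j (Finset.mem_sdiff.2 ⟨hj, hjI⟩), one_zpow]
  exact DFunLike.congr_fun this ν

/-- The condition cuts out a subgroup, by invariance of `ψ`, and holds for the generators. It is the
upper bound for `J_{I,t} A` from which all nonmembership statements follow. -/
theorem mem_JA (h : IsSystem l p x s σ α β) (hI : IsIndexSet l I) (hA : A ≤ AI l α β I)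
    {ψ : N →* MulAut N} (hψI : ∀ i ∈ I, ψ (σ i) = α (i - 1) ^ t i)
    (hψ : ∀ j ∈ Finset.Icc 1 l \ I, ψ (σ j) = 1) {g : Hol N} (hg : g ∈ JA l σ α I t A) :
    (∀ i ∈ I, g.right (σ i) = σ i) ∧ (ψ g.left)⁻¹ * g.right ∈ A := by
  let Γ : Subgroup (Hol N) :=
    { carrier := {g | (∀ i ∈ I, g.right (σ i) = σ i) ∧ (ψ g.left)⁻¹ * g.right ∈ A}
      one_mem' := ⟨fun i _ => rfl, by
        rw [SemidirectProduct.one_left, SemidirectProduct.one_right, map_one, inv_one, mul_one]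
        exact A.one_mem⟩
      mul_mem' := by
        rintro a b ⟨ha, ha'⟩ ⟨hb, hb'⟩
        refine ⟨fun i hi => ?_, ?_⟩
        · rw [SemidirectProduct.mul_right, MulAut.mul_apply, hb i hi, ha i hi]
        · rw [SemidirectProduct.mul_left, SemidirectProduct.mul_right, MonoidHom.id_apply, map_mul,
            h.twist_apply hψ ha, aut_inv_mul_mul]
          exact A.mul_mem ha' hb'
      inv_mem' := by
        rintro a ⟨ha, ha'⟩
        have hinv : ∀ i ∈ I, a.right⁻¹ (σ i) = σ i := fun i hi =>
          (fixer (σ i)).inv_mem (mem_fixer.2 (ha i hi))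
        refine ⟨hinv, ?_⟩
        rw [SemidirectProduct.inv_left, SemidirectProduct.inv_right, MonoidHom.id_apply,
          h.twist_apply hψ hinv, map_inv, inv_inv, aut_mul_comm, ← inv_inv (ψ a.left),
          ← mul_inv_rev]
        exact A.inv_mem ha' }
  suffices hle : JA l σ α I t A ≤ Γ from hle hg
  refine sup_le ((Subgroup.closure_le _).2 ?_) (Subgroup.map_le_iff_le_comap.2 ?_)
  · rintro g (⟨j, hj, rfl⟩ | ⟨i, hi, rfl⟩)
    · refine ⟨fun i _ => rfl, ?_⟩
      rw [SemidirectProduct.left_inl, SemidirectProduct.right_inl, hψ j hj, inv_one, mul_one]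
      exact A.one_mem
    · refine ⟨fun k hk => h.alpha_pred_fix hI hi hk _, ?_⟩
      change (ψ (σ i))⁻¹ * α (i - 1) ^ t i ∈ A
      rw [hψI i hi, inv_mul_cancel]
      exact A.one_mem
  · intro γ hγ
    refine ⟨fun i hi => h.AI_le_fixer hi (hI.mem_Icc hi) (hA hγ), ?_⟩
    rw [SemidirectProduct.left_inr, SemidirectProduct.right_inr, map_one, inv_one, one_mul]
    exact hγ

theorem right_apply_of_mem_JA (h : IsSystem l p x s σ α β) (hI : IsIndexSet l I)
    (hA : A ≤ AI l α β I) {g : Hol N} (hg : g ∈ JA l σ α I t A) {i : ℕ} (hi : i ∈ I) :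
    g.right (σ i) = σ i := by
  obtain ⟨ψ, hψI, hψ⟩ := h.exists_twist hI t
  exact (h.mem_JA hI hA hψI hψ hg).1 i hi

theorem inr_mem_JA (h : IsSystem l p x s σ α β) (hI : IsIndexSet l I) (hA : A ≤ AI l α β I)
    {γ : MulAut N} : (SemidirectProduct.inr γ : Hol N) ∈ JA l σ α I t A ↔ γ ∈ A := by
  refine ⟨fun hγ => ?_, fun hγ => le_sup_right (a := J l σ α I t) (Subgroup.mem_map_of_mem _ hγ)⟩
  obtain ⟨ψ, hψI, hψ⟩ := h.exists_twist hI t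
  have h1 := (h.mem_JA hI hA hψI hψ hγ).2
  rwa [SemidirectProduct.left_inr, SemidirectProduct.right_inr, map_one, inv_one, one_mul] at h1

theorem inl_aut_mem_J {j : ℕ} (hj : j ∈ Finset.Icc 1 l \ I) (γ : MulAut N) :
    (SemidirectProduct.inl (γ (σ j)) : Hol N) ∈ J l σ α I t :=
  aut_apply_mem γ ((J l σ α I t).comap SemidirectProduct.inl) (inl_mem_J hj)

/-- For `j ∈ I`, having both `σ j` and `[σ j, α (j - 1) ^ t j]` would put a nontrivial automorphism
of order `p j` into `A`. -/
theorem inl_sigma_mem_JA (h : IsSystem l p x s σ α β) (hI : IsIndexSet l I) (hA : A ≤ AI l α β I)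
    (ht : IsExponent p I t) {j : ℕ} (hj : j ∈ Finset.Icc 1 l) :
    (SemidirectProduct.inl (σ j) : Hol N) ∈ JA l σ α I t A ↔ j ∉ I := by
  refine ⟨fun h1 hjI => ?_, fun hjI => J_le_JA (inl_mem_J (Finset.mem_sdiff.2 ⟨hj, hjI⟩))⟩
  have h2 := inr_inv_mul_mem (γ := 1) h1 (J_le_JA (A := A) (mk_mem_J hjI))
  rw [inv_one, one_mul, h.inr_mem_JA hI hA] at h2
  have h3 := h.coprime_orderOf_of_mem_AI hjI hj (hA h2)
  refine h.alpha_pow_ne_one hI ht hjI (eq_one_of_pow_eq_one_of_coprime (pow_orderOf_eq_one _) ?_ h3)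
  obtain ⟨k, hk, rfl, -⟩ := hI.exists_pred hjI
  rw [Nat.add_sub_cancel, ← pow_mul, mul_comm, pow_mul, (h.alpha_pow_eq_one_iff hk).2 dvd_rfl,
    one_pow]

theorem exists_mem_J (h : IsSystem l p x s σ α β) (hI : IsIndexSet l I) (t : ℕ → ℕ) (ν : N) :
    ∃ g ∈ J l σ α I t, g.left = ν := by
  have := h.finite
  -- The translation parts of a subgroup need not form a subgroup. The elements by which every
  -- translation part may be multiplied do, by finiteness, and each `σ j` is one of them.
  let T : Submonoid N :=
    { carrier := {ν | ∀ g ∈ J l σ α I t, ∃ g' ∈ J l σ α I t, g'.left = g.left * ν}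
      one_mem' := fun g hg => ⟨g, hg, (mul_one g.left).symm⟩
      mul_mem' := fun {a b} ha hb g hg => by
        obtain ⟨g1, hg1, e1⟩ := ha g hg
        obtain ⟨g2, hg2, e2⟩ := hb g1 hg1
        exact ⟨g2, hg2, by rw [e2, e1, mul_assoc]⟩ }
  let H : Subgroup N :=
    { T with
      inv_mem' := fun {a} ha => by
        have : a⁻¹ = a ^ (orderOf a - 1) := by
          rw [inv_eq_iff_mul_eq_one, ← pow_succ', Nat.sub_add_cancel (orderOf_pos a),
            pow_orderOf_eq_one]
        rw [this]
        exact T.pow_mem ha _ }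
  have hH : H = ⊤ := h.eq_top_of_sigma_mem fun j hj g hg => by
    by_cases hjI : j ∈ I
    · refine ⟨_, (J l σ α I t).mul_mem hg (mk_mem_J hjI), ?_⟩
      rw [SemidirectProduct.mul_left, MonoidHom.id_apply,
        h.right_apply_of_mem_JA (A := ⊥) hI bot_le (J_le_JA hg) hjI]
    -- Applying `g.right⁻¹` compensates for the action of `g` on the translation that follows it.
    · refine ⟨_, (J l σ α I t).mul_mem hg (inl_aut_mem_J (Finset.mem_sdiff.2 ⟨hj, hjI⟩) g.right⁻¹), ?_⟩
      rw [SemidirectProduct.mul_left, SemidirectProduct.left_inl, MonoidHom.id_apply,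
        MulAut.apply_inv_self]
  obtain ⟨g, hg, e⟩ := (hH ▸ Subgroup.mem_top ν : ν ∈ H) 1 (J l σ α I t).one_mem
  exact ⟨g, hg, by rw [e, SemidirectProduct.one_left, one_mul]⟩

theorem isPretransitive_JA (h : IsSystem l p x s σ α β) (hI : IsIndexSet l I) :
    MulAction.IsPretransitive (JA l σ α I t A) N :=
  (isPretransitive_iff _).2 fun ν => by
    obtain ⟨g, hg, e⟩ := h.exists_mem_J hI t ν
    exact ⟨g, J_le_JA hg, e⟩

theorem J_inf_inHol (h : IsSystem l p x s σ α β) (hI : IsIndexSet l I) :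
    J l σ α I t ⊓ inHol A = ⊥ := by
  rw [eq_bot_iff]
  rintro _ ⟨hg, γ, -, rfl⟩
  -- `J` itself is handled as the case of trivial `A`.
  have h1 := (h.inr_mem_JA (A := ⊥) hI bot_le).1 (J_le_JA hg)
  rw [Subgroup.mem_bot.1 h1, map_one]
  exact Subgroup.one_mem _

/-- Conjugation by `γ` maps each `σ j` with `j ∉ I` into its own cyclic group and fixes the other
generators, as `Aut N` is abelian. -/
theorem conj_mem_of_mem_J {γ : MulAut N}
    (hγ : ∀ i ∈ I, γ (σ i) = σ i) {g : Hol N} (hg : g ∈ J l σ α I t) :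
    SemidirectProduct.inr γ * g * (SemidirectProduct.inr γ)⁻¹ ∈ J l σ α I t := by
  have key : J l σ α I t ≤ (J l σ α I t).comap
      (MulAut.conj (SemidirectProduct.inr γ : Hol N)).toMonoidHom := by
    refine (Subgroup.closure_le _).2 ?_
    rintro g (⟨j, hj, rfl⟩ | ⟨i, hi, rfl⟩)
    · change SemidirectProduct.inr γ * SemidirectProduct.inl (σ j) * (SemidirectProduct.inr γ)⁻¹ ∈
        J l σ α I t
      rw [← map_inv, ← SemidirectProduct.inl_aut]
      exact inl_aut_mem_J hj γ
    · change SemidirectProduct.inr γ * _ * (SemidirectProduct.inr γ)⁻¹ ∈ J l σ α I t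
      have : (SemidirectProduct.inr γ * ⟨σ i, α (i - 1) ^ t i⟩ * (SemidirectProduct.inr γ)⁻¹ : Hol N)
          = ⟨σ i, α (i - 1) ^ t i⟩ := by
        rw [mul_inv_eq_iff_eq_mul]
        change (⟨1, γ⟩ * ⟨σ i, α (i - 1) ^ t i⟩ : Hol N) = ⟨σ i, α (i - 1) ^ t i⟩ * ⟨1, γ⟩
        rw [mk_mul_mk, mk_mul_mk, hγ i hi, map_one, mul_one, one_mul, aut_mul_comm]
      rw [this]
      exact mk_mem_J hi
  exact key hg

theorem inHol_le_normalizer (h : IsSystem l p x s σ α β) (hI : IsIndexSet l I)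
    (hA : A ≤ AI l α β I) :
    inHol A ≤ Subgroup.normalizer (J l σ α I t : Set (Hol N)) := by
  rintro _ ⟨γ, hγ, rfl⟩
  have hfix : ∀ γ ∈ A, ∀ i ∈ I, γ (σ i) = σ i := fun γ hγ i hi =>
    h.AI_le_fixer hi (hI.mem_Icc hi) (hA hγ)
  rw [Subgroup.mem_normalizer_iff]
  refine fun g => ⟨conj_mem_of_mem_J (hfix γ hγ), fun hg => ?_⟩
  have h1 := conj_mem_of_mem_J (hfix _ (A.inv_mem hγ)) hg
  rw [map_inv, inv_inv] at h1
  simpa only [mul_assoc, inv_mul_cancel_left, inv_mul_cancel, mul_one] using h1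

end IsSystem

section

variable {N : Type*} [CommGroup N] {l : ℕ} {σ : ℕ → N} {α : ℕ → MulAut N} {I : Finset ℕ}
  {t t' : ℕ → ℕ} {A : Subgroup (MulAut N)}

theorem JA_congr (htt' : ∀ i ∈ I, t i = t' i) : JA l σ α I t A = JA l σ α I t' A := by
  have : {g : Hol N | ∃ i ∈ I, g = ⟨σ i, α (i - 1) ^ t i⟩} =
      {g | ∃ i ∈ I, g = ⟨σ i, α (i - 1) ^ t' i⟩} := by
    ext g
    refine exists_congr fun i => and_congr_right fun hi => ?_
    rw [htt' i hi]
  rw [JA, JA, J, J, this]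

/-- The required bijection of `N` is `θ` itself. -/
theorem permIsomorphic_map_conj {M M' : Subgroup (Hol N)} (θ : MulAut N)
    (hM : M.map (MulAut.conj (SemidirectProduct.inr θ : Hol N)).toMonoidHom = M') :
    PermIsomorphic M M' := by
  refine ⟨(M.equivMapOfInjective _ (MulEquiv.injective _)).trans (MulEquiv.subgroupCongr hM),
    θ.toEquiv, fun m μ => ?_⟩
  have hθ : ∀ ν : N, θ ν = (SemidirectProduct.inr θ : Hol N) • ν := fun ν => by
    rw [hol_smul, SemidirectProduct.left_inr, SemidirectProduct.right_inr, one_mul]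
  change θ ((m : Hol N) • μ) =
    (SemidirectProduct.inr θ * (m : Hol N) * (SemidirectProduct.inr θ)⁻¹ : Hol N) • θ μ
  rw [hθ, hθ, mul_smul, mul_smul, inv_smul_smul]

end

namespace IsSystem

variable {N : Type*} [CommGroup N] [IsCyclic N] {l : ℕ} {p : ℕ → ℕ} {x s : ℕ}
  {σ : ℕ → N} {α β : ℕ → MulAut N} {I : Finset ℕ} {t t' : ℕ → ℕ} {A : Subgroup (MulAut N)}

/-! ### Counting the exponent sequences. -/

section Counting

/-- If both exponents occur, the quotient of the two powers of `α (i - 1)` lies in `A`; it is killed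
by `p i` but has order prime to `p i`. -/
theorem exponent_eq (h : IsSystem l p x s σ α β) (hI : IsIndexSet l I) (hA : A ≤ AI l α β I)
    (ht : IsExponent p I t) (ht' : IsExponent p I t')
    (hJA : JA l σ α I t A = JA l σ α I t' A) {i : ℕ} (hi : i ∈ I) : t i = t' i := by
  have h1 : (⟨σ i, α (i - 1) ^ t i⟩ : Hol N) ∈ JA l σ α I t' A := hJA ▸ J_le_JA (mk_mem_J hi)
  have h2 := inr_inv_mul_mem h1 (J_le_JA (mk_mem_J hi))
  rw [h.inr_mem_JA hI hA] at h2
  have h3 := h.coprime_orderOf_of_mem_AI hi (hI.mem_Icc hi) (hA h2)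
  have hi' := hI.mem_Icc hi
  have ht1 := ht i hi
  have ht2 := ht' i hi
  have hpos := (h.prime hi').pos
  obtain ⟨j, hj, rfl, -⟩ := hI.exists_pred hi
  rw [Nat.add_sub_cancel] at h2 h3
  have hpow : ∀ n : ℕ, (α j ^ n) ^ p (j + 1) = 1 := fun n => by
    rw [← pow_mul, h.alpha_pow_eq_one_iff hj]
    exact dvd_mul_left _ _
  have h4 : (α j ^ t (j + 1))⁻¹ * α j ^ t' (j + 1) = 1 := by
    refine eq_one_of_pow_eq_one_of_coprime (pow_orderOf_eq_one _) ?_ h3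
    rw [Commute.mul_pow (aut_mul_comm _ _), inv_pow, hpow, hpow, inv_one, mul_one]
  rw [inv_mul_eq_one, pow_eq_pow_iff_modEq, h.order_alpha j hj] at h4
  exact Nat.ModEq.eq_of_lt_of_lt h4 (by omega) (by omega)

theorem ncard_family (h : IsSystem l p x s σ α β) (hI : IsIndexSet l I) (hA : A ≤ AI l α β I) :
    (family l p σ α I A).ncard = ∏ i ∈ I, (p i - 1) := by
  classical
  -- Only the values on `I` matter, so sequences on `I` are extended by the irrelevant value `0`.
  let ext : (∀ i ∈ I, ℕ) → ℕ → ℕ := fun f i => if hi : i ∈ I then f i hi else 0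
  have hext : ∀ f ∈ I.pi fun i => Finset.Icc 1 (p i - 1), IsExponent p I (ext f) :=
    fun f hf i hi => by
      have := Finset.mem_Icc.1 (Finset.mem_pi.1 hf i hi)
      simpa only [ext, dif_pos hi] using this
  have himage : family l p σ α I A =
      (fun f => JA l σ α I (ext f) A) '' ↑(I.pi fun i => Finset.Icc 1 (p i - 1)) := by
    ext M
    constructor
    · rintro ⟨t, ht, rfl⟩
      refine ⟨fun i _ => t i, Finset.mem_coe.2 (Finset.mem_pi.2 fun i hi =>
        Finset.mem_Icc.2 (ht i hi)), JA_congr fun i hi => ?_⟩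
      simp only [ext, dif_pos hi]
    · rintro ⟨f, hf, rfl⟩
      exact ⟨ext f, hext f hf, rfl⟩
  rw [himage, Set.InjOn.ncard_image, Set.ncard_coe_finset, Finset.card_pi]
  · simp only [Nat.card_Icc, Nat.add_sub_cancel]
  · intro f hf g hg hfg
    funext i hi
    have := h.exponent_eq hI hA (hext f hf) (hext g hg) hfg hi
    simpa only [ext, dif_pos hi] using this

end Counting

/-! ### Conjugation by automorphisms of `N`. -/

section PermutationIsomorphism

theorem conj_inr_mk (θ γ : MulAut N) (ν : N) :
    MulAut.conj (SemidirectProduct.inr θ : Hol N) ⟨ν, γ⟩ = ⟨θ ν, γ⟩ := by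
  rw [MulAut.conj_apply, mul_inv_eq_iff_eq_mul]
  change (⟨1, θ⟩ * ⟨ν, γ⟩ : Hol N) = ⟨θ ν, γ⟩ * ⟨1, θ⟩
  rw [mk_mul_mk, mk_mul_mk, map_one, mul_one, one_mul, aut_mul_comm]

/-- Conjugation by `θ` sends `[σ i, α (i - 1) ^ t i]` to the `k i`-th power of `[σ i, α (i - 1) ^ t'
i]`, which generates the same group of order `p i`. -/
theorem map_conj_JA (h : IsSystem l p x s σ α β) (hI : IsIndexSet l I) {k : ℕ → ℕ}
    (hk : ∀ i ∈ I, (k i).Coprime (p i)) (htt' : ∀ i ∈ I, t i ≡ t' i * k i [MOD p i])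
    {θ : MulAut N} (hθ : ∀ i ∈ I, θ (σ i) = σ i ^ k i) :
    (JA l σ α I t A).map (MulAut.conj (SemidirectProduct.inr θ : Hol N)).toMonoidHom =
      JA l σ α I t' A := by
  have hgen : ∀ i ∈ I, MulAut.conj (SemidirectProduct.inr θ : Hol N) ⟨σ i, α (i - 1) ^ t i⟩ =
      ⟨σ i, α (i - 1) ^ t' i⟩ ^ k i := fun i hi => by
    rw [conj_inr_mk, mk_pow_of_fixed (h.alpha_pred_fix hI hi hi _), hθ i hi, ← pow_mul]
    have := htt' i hi
    obtain ⟨j, hj, rfl, -⟩ := hI.exists_pred hi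
    have h1 : α j ^ t (j + 1) = α j ^ (t' (j + 1) * k (j + 1)) := by
      rwa [pow_eq_pow_iff_modEq, h.order_alpha j hj]
    rw [Nat.add_sub_cancel, h1]
  have hord : ∀ i ∈ I, (⟨σ i, α (i - 1) ^ t' i⟩ : Hol N) ^ p i = 1 := fun i hi => by
    rw [mk_pow_of_fixed (h.alpha_pred_fix hI hi hi _), h.sigma_pow (hI.mem_Icc hi), ← pow_mul]
    obtain ⟨j, hj, rfl, -⟩ := hI.exists_pred hi
    rw [Nat.add_sub_cancel, (h.alpha_pow_eq_one_iff hj).2 (dvd_mul_left _ _)]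
    rfl
  refine le_antisymm (Subgroup.map_le_iff_le_comap.2 (sup_le ((Subgroup.closure_le _).2 ?_)
    (Subgroup.map_le_iff_le_comap.2 fun γ hγ => ?_))) (sup_le ((Subgroup.closure_le _).2 ?_)
    (Subgroup.map_le_iff_le_comap.2 fun γ hγ => ?_))
  · rintro g (⟨j, hj, rfl⟩ | ⟨i, hi, rfl⟩)
    · change MulAut.conj (SemidirectProduct.inr θ : Hol N) ⟨σ j, 1⟩ ∈ JA l σ α I t' A
      rw [conj_inr_mk]
      exact J_le_JA (inl_aut_mem_J hj θ)
    · change MulAut.conj (SemidirectProduct.inr θ : Hol N) ⟨σ i, α (i - 1) ^ t i⟩ ∈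
        JA l σ α I t' A
      rw [hgen i hi]
      exact Subgroup.pow_mem _ (J_le_JA (mk_mem_J hi)) _
  · change MulAut.conj (SemidirectProduct.inr θ : Hol N) ⟨1, γ⟩ ∈ JA l σ α I t' A
    rw [conj_inr_mk, map_one]
    exact (le_sup_right : inHol A ≤ _) (Subgroup.mem_map_of_mem _ hγ)
  · rintro g (⟨j, hj, rfl⟩ | ⟨i, hi, rfl⟩)
    · refine ⟨⟨θ⁻¹ (σ j), 1⟩, J_le_JA (inl_aut_mem_J hj θ⁻¹), ?_⟩
      change MulAut.conj (SemidirectProduct.inr θ : Hol N) ⟨θ⁻¹ (σ j), 1⟩ = _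
      rw [conj_inr_mk, MulAut.apply_inv_self]
      rfl
    · have hcop : (k i).Coprime (orderOf (⟨σ i, α (i - 1) ^ t' i⟩ : Hol N)) :=
        (hk i hi).coprime_dvd_right (orderOf_dvd_of_pow_eq_one (hord i hi))
      obtain ⟨n, hn⟩ := exists_pow_eq_self_of_coprime hcop
      have hmem : (⟨σ i, α (i - 1) ^ t' i⟩ : Hol N) ^ k i ∈ (JA l σ α I t A).map
          (MulAut.conj (SemidirectProduct.inr θ : Hol N)).toMonoidHom :=
        ⟨_, J_le_JA (mk_mem_J hi), hgen i hi⟩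
      have := Subgroup.pow_mem _ hmem n
      rwa [hn] at this
  · refine ⟨⟨1, γ⟩, (le_sup_right : inHol A ≤ _) (Subgroup.mem_map_of_mem _ hγ), ?_⟩
    change MulAut.conj (SemidirectProduct.inr θ : Hol N) ⟨1, γ⟩ = _
    rw [conj_inr_mk, map_one]
    rfl

theorem coprime_of_isExponent (h : IsSystem l p x s σ α β) (hI : IsIndexSet l I)
    (ht : IsExponent p I t) {i : ℕ} (hi : i ∈ I) : (t i).Coprime (p i) := by
  have h1 := ht i hi
  have h2 := (h.prime (hI.mem_Icc hi)).pos
  exact (Nat.coprime_of_lt_prime (by omega) (by omega) (h.prime (hI.mem_Icc hi))).symm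

theorem permIsomorphic_of_mem_family (h : IsSystem l p x s σ α β) (hI : IsIndexSet l I)
    {M M' : Subgroup (Hol N)} (hM : M ∈ family l p σ α I A) (hM' : M' ∈ family l p σ α I A) :
    PermIsomorphic M M' := by
  obtain ⟨t, ht, rfl⟩ := hM
  obtain ⟨t', ht', rfl⟩ := hM'
  -- For `i ∈ I` the exponent is `t i` divided by `t' i` modulo `p i`; elsewhere it is `1`.
  have hex : ∀ i, ∃ k : ℕ, (i ∈ Finset.Icc 1 l → k.Coprime (p i)) ∧
      (i ∈ I → t i ≡ t' i * k [MOD p i]) := fun i => by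
    by_cases hi : i ∈ I
    · have hc := h.coprime_of_isExponent hI ht hi
      obtain ⟨c, -, hc'⟩ := Nat.exists_mul_mod_eq_one_of_coprime
        (h.coprime_of_isExponent hI ht' hi) (h.prime (hI.mem_Icc hi)).one_lt
      have hc1 : t' i * c ≡ 1 [MOD p i] := by
        rw [Nat.ModEq, hc', Nat.mod_eq_of_lt (h.prime (hI.mem_Icc hi)).one_lt]
      have hcc : c.Coprime (p i) := by
        have h1 : (t' i * c).Coprime (p i) := by
          rw [Nat.coprime_iff_gcd_eq_one, hc1.gcd_eq, Nat.gcd_one_left]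
        exact h1.coprime_mul_left
      refine ⟨c * t i, fun _ => hcc.mul_left hc, fun _ => ?_⟩
      rw [← mul_assoc]
      simpa using (hc1.mul_right (t i)).symm
    · exact ⟨1, fun _ => Nat.coprime_one_left _, fun hi' => (hi hi').elim⟩
  choose k hk1 hk2 using hex
  obtain ⟨θ, hθ⟩ := h.exists_aut k hk1
  exact permIsomorphic_map_conj θ (h.map_conj_JA hI (fun i hi => hk1 i (hI.mem_Icc hi)) hk2
    fun i hi => hθ i (hI.mem_Icc hi))

end PermutationIsomorphism

end IsSystem

/-! ### Classification of the transitive subgroups. -/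

section

variable {N : Type*} [CommGroup N] {l : ℕ} {σ : ℕ → N} {M : Subgroup (Hol N)}

open Classical in
/-- The indices `i` such that `σ i` does not belong to the given subgroup. -/
noncomputable def missing (l : ℕ) (σ : ℕ → N) (M : Subgroup (Hol N)) : Finset ℕ :=
  (Finset.Icc 1 l).filter fun i => (SemidirectProduct.inl (σ i) : Hol N) ∉ M

theorem mem_missing {i : ℕ} : i ∈ missing l σ M ↔
    i ∈ Finset.Icc 1 l ∧ (SemidirectProduct.inl (σ i) : Hol N) ∉ M := by
  classical
  rw [missing, Finset.mem_filter]

end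

namespace IsSystem

variable {N : Type*} [CommGroup N] [IsCyclic N] {l : ℕ} {p : ℕ → ℕ} {x s : ℕ}
  {σ : ℕ → N} {α β : ℕ → MulAut N} {M : Subgroup (Hol N)}

section Classification

/-- If a transitive subgroup does not contain `σ i`, then it acts on the `i`-th component by
translations. -/
theorem right_apply_of_inl_notMem (h : IsSystem l p x s σ α β)
    (hM : MulAction.IsPretransitive M N) {i : ℕ} (hi : i ∈ Finset.Icc 1 l)
    (hiM : (SemidirectProduct.inl (σ i) : Hol N) ∉ M) {g : Hol N} (hg : g ∈ M) :
    g.right (σ i) = σ i := by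
  rw [isPretransitive_iff] at hM
  have hself : ∀ ν ∈ Subgroup.zpowers (σ i), ν ^ h.idem i = ν := fun ν hν =>
    h.pow_idem_self hi (by
      obtain ⟨k, rfl⟩ := Subgroup.mem_zpowers_iff.1 hν
      rw [← zpow_natCast, zpow_comm, zpow_natCast, h.sigma_pow hi, one_zpow])
  -- Commutators are translations in `M`, and those have no `i`-th component: on that component `g`
  -- and `k` commute.
  have key : ∀ k ∈ M, g.left ^ h.idem i * g.right (k.left ^ h.idem i) =
      k.left ^ h.idem i * k.right (g.left ^ h.idem i) := fun k hk => by
    have h1 := h.pow_idem_eq_one (H := M.comap SemidirectProduct.inl) hi hiM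
      (commutator_mem hg hk)
    rwa [div_pow, div_eq_one, mul_pow, mul_pow, ← map_pow, ← map_pow] at h1
  by_contra hne
  have hτ : σ i / g.right (σ i) ∈ Subgroup.zpowers (σ i) :=
    Subgroup.div_mem _ (Subgroup.mem_zpowers _) (aut_apply_mem_zpowers _ _)
  have h1 := mem_zpowers_of_prime_orderOf (h.prime_orderOf hi) hτ
    fun h1 => hne (div_eq_one.1 h1).symm
  -- This `z` makes `σ i ^ z` a fixed point of `g` on the `i`-th component. An element commuting
  -- with `g` there carries `1` to it, so `g` fixes `1`; another carries `1` to `σ i`, so `g` fixes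
  -- `σ i` as well.
  obtain ⟨z, hz⟩ := Subgroup.mem_zpowers_iff.1
    (Subgroup.zpowers_le.2 h1 (h.pow_idem_mem hi g.left))
  have hleft : g.left ^ h.idem i = 1 := by
    obtain ⟨k, hk, hkl⟩ := hM (σ i ^ z)
    have h2 := key k hk
    rw [hkl, hself _ (Subgroup.zpow_mem _ (Subgroup.mem_zpowers _) z)] at h2
    nth_rewrite 1 [← hz] at h2
    rw [div_zpow, ← map_zpow, div_mul_cancel, left_eq_mul] at h2
    exact (map_eq_one_iff _ (MulEquiv.injective _)).1 h2
  obtain ⟨k, hk, hkl⟩ := hM (σ i)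
  have h3 := key k hk
  rw [hleft, hkl, hself _ (Subgroup.mem_zpowers _), one_mul, map_one, mul_one] at h3
  exact hne h3

/-- A power of some `[σ i, γ]` in `M` has an automorphism part that is a power of `α j` with `j = i
- 1`. That part is nontrivial because `σ i ∉ M`; as it moves `σ j`, the group cannot act on the
`j`-th component by translations, so `σ j ∈ M`. -/
theorem exists_mk_mem (h : IsSystem l p x s σ α β)
    (hM : MulAction.IsPretransitive M N) {i : ℕ} (hi : i ∈ Finset.Icc 1 l)
    (hiM : (SemidirectProduct.inl (σ i) : Hol N) ∉ M) :
    ∃ j ∈ Finset.Ico 1 l, j + 1 = i ∧ (SemidirectProduct.inl (σ j) : Hol N) ∈ M ∧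
      ∃ t : ℕ, (1 ≤ t ∧ t ≤ p i - 1) ∧ (⟨σ i, α j ^ t⟩ : Hol N) ∈ M := by
  classical
  obtain ⟨⟨-, γ⟩, hγM, rfl⟩ := (isPretransitive_iff M).1 hM (σ i)
  have hγ : γ (σ i) = σ i := h.right_apply_of_inl_notMem hM hi hiM hγM
  obtain ⟨E, hE, hEγ⟩ := h.exists_exponent hi
  obtain ⟨h1, h2⟩ := hEγ γ
  -- `c` inverts `E` modulo `p i`, so the power `E * c` restores `σ i`.
  obtain ⟨c, hc⟩ := exists_pow_eq_self_of_coprime (x := σ i) (n := E)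
    (by rwa [h.order_sigma i hi])
  have hpow : (⟨σ i, (γ ^ E) ^ c⟩ : Hol N) ∈ M := by
    have h3 := M.pow_mem (M.pow_mem hγM E) c
    rwa [mk_pow_of_fixed hγ,
      mk_pow_of_fixed (by rw [map_pow, mem_fixer.1 ((fixer (σ i)).pow_mem (mem_fixer.2 hγ) E)]),
      hc] at h3
  have hne : (γ ^ E) ^ c ≠ 1 := fun h3 => hiM (by rw [h3] at hpow; exact hpow)
  by_cases hj : ∃ j ∈ Finset.Ico 1 l, j + 1 = i
  · obtain ⟨j, hj, rfl⟩ := hj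
    have hj' := Finset.Ico_subset_Icc_self hj
    have hfin : IsOfFinOrder (α j) := by
      rw [← orderOf_pos_iff, h.order_alpha j hj]
      exact (h.prime hi).pos
    have h4 := Subgroup.pow_mem _ (h2 j hj rfl) c
    rw [hfin.mem_zpowers_iff_mem_range_orderOf, Finset.mem_image] at h4
    obtain ⟨t, ht, h5⟩ := h4
    rw [Finset.mem_range, h.order_alpha j hj] at ht
    rw [← h5] at hpow hne
    have ht0 : t ≠ 0 := fun h0 => hne (by rw [h0, pow_zero])
    refine ⟨j, hj, rfl, ?_, t, ⟨by omega, by omega⟩, hpow⟩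
    by_contra hjM
    have h6 := h.right_apply_of_inl_notMem hM hj' hjM hpow
    refine hne (h.aut_ext fun k hk => ?_)
    by_cases hjk : j = k
    · subst hjk
      exact h6
    · exact (fixer (σ k)).pow_mem (mem_fixer.2 (h.alpha_fix j hj' k hk hjk)) t
  -- This is the case `i = 1`, where `γ ^ E` is trivial on every component.
  · refine (hne ?_).elim
    have : γ ^ E = 1 := h.aut_ext fun k hk => h1 k hk fun hki => hj ⟨k, by
      rw [Finset.mem_Icc] at hk hi
      exact Finset.mem_Ico.2 ⟨hk.1, by omega⟩, hki⟩
    rw [this, one_pow]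

theorem isIndexSet_missing (h : IsSystem l p x s σ α β) (hM : MulAction.IsPretransitive M N) :
    IsIndexSet l (missing l σ M) := by
  refine ⟨fun i hi => ?_, fun i hi hi' => ?_⟩
  · rw [mem_missing] at hi
    obtain ⟨j, hj, rfl, -⟩ := h.exists_mk_mem hM hi.1 hi.2
    rw [Finset.mem_Ico] at hj
    exact Finset.mem_Icc.2 ⟨by omega, hj.2⟩
  · rw [mem_missing] at hi hi'
    obtain ⟨j, -, hji, hjM, -⟩ := h.exists_mk_mem hM hi'.1 hi'.2
    obtain rfl : j = i := by omega
    exact hi.2 hjM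

/-- On a missing component `γ` is trivial. If `j + 1` is missing, a nontrivial `p (j + 1)`-part of
`γ` would put `α j`, hence `σ (j + 1)`, into `M`, so `γ` acts on component `j` as a power of `β j`.
On the remaining components `α j` and `β j` give everything. -/
theorem comap_inr_le_AI (h : IsSystem l p x s σ α β) (hM : MulAction.IsPretransitive M N) :
    M.comap SemidirectProduct.inr ≤ AI l α β (missing l σ M) := by
  intro γ hγ
  refine h.mem_of_components γ fun j hj => ?_
  have hbeta : j ∉ missing l σ M → β j ∈ AI l α β (missing l σ M) := fun hjM =>
    Subgroup.subset_closure (Or.inr ⟨j, Finset.mem_sdiff.2 ⟨hj, hjM⟩, rfl⟩)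
  by_cases hjM : j ∈ missing l σ M
  · refine ⟨1, Subgroup.one_mem _, ?_, fun _ _ _ => rfl⟩
    rw [mem_missing] at hjM
    exact (h.right_apply_of_inl_notMem hM hj hjM.2 hγ).symm
  by_cases hjM' : j + 1 ∈ missing l σ M
  · rw [mem_missing] at hjM'
    obtain ⟨k, hk, hkj, -, t, -, ht⟩ := h.exists_mk_mem hM hjM'.1 hjM'.2
    obtain rfl : k = j := by omega
    obtain ⟨E, hE, hEγ⟩ := h.exists_exponent hjM'.1
    have hγE : γ ^ E = 1 := by
      by_contra hne
      have h1 := mem_zpowers_of_prime_orderOf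
        (by rw [h.order_alpha k hk]; exact h.prime hjM'.1) ((hEγ γ).2 k hk rfl) hne
      have h2 : α k ^ t ∈ M.comap SemidirectProduct.inr :=
        Subgroup.pow_mem (M.comap SemidirectProduct.inr)
          (Subgroup.zpowers_le.2 (Subgroup.pow_mem (M.comap SemidirectProduct.inr) hγ E) h1) t
      have h3 := inl_div_mem ht (b := 1) h2
      rw [div_one] at h3
      exact hjM'.2 h3
    have := h.isCyclic_units hj
    have := Fact.mk (h.prime_orderOf hj)
    have hsq : (char (σ k) γ) ^ 2 = 1 := by
      refine eq_one_of_pow_eq_one_of_coprime (m := E) (n := p (k + 1)) ?_ ?_ hE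
      · rw [← map_pow, ← map_pow, ← pow_mul, mul_comm, pow_mul, hγE, one_pow, map_one]
      · rw [← pow_mul, ← h.sub_one_eq hk, ← h.order_sigma k hj,
          ZMod.units_pow_card_sub_one_eq_one]
    have hmem : char (σ k) γ ∈ Subgroup.zpowers (char (σ k) (β k)) := by
      refine mem_zpowers_of_pow_orderOf_eq_one ?_
      rw [h.orderOf_char (h.beta_fix k hj), h.order_beta k hk, hsq]
    obtain ⟨z, hz⟩ := Subgroup.mem_zpowers_iff.1 hmem
    refine ⟨β k ^ z, Subgroup.zpow_mem _ (hbeta hjM) z, ?_, fun i hi hki => ?_⟩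
    · rw [← char_eq_iff, map_zpow, hz]
    · exact (fixer (σ i)).zpow_mem (mem_fixer.2 (h.beta_fix k hj i hi hki)) z
  · obtain ⟨δ, hδ, hδγ⟩ := h.exists_mem_closure hj (char (σ j) γ)
    refine ⟨δ, ?_, char_eq_iff.1 hδγ, fun i hi hji => h.closure_fix hj hi hji hδ⟩
    refine (Subgroup.closure_le _).2 ?_ hδ
    rintro ε (rfl | rfl)
    · exact Subgroup.subset_closure
        (Or.inl ⟨j, Finset.mem_filter.2 ⟨hj, hjM, hjM'⟩, rfl⟩)
    · exact hbeta hjM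

/-- The transitive subgroups of the holomorph. -/
theorem exists_mem_family (h : IsSystem l p x s σ α β) (hM : MulAction.IsPretransitive M N) :
    ∃ (I : Finset ℕ) (A : Subgroup (MulAut N)),
      IsIndexSet l I ∧ A ≤ AI l α β I ∧ M ∈ family l p σ α I A := by
  have hI := h.isIndexSet_missing hM
  refine ⟨missing l σ M, M.comap SemidirectProduct.inr, hI, h.comap_inr_le_AI hM, ?_⟩
  have hex : ∀ i, ∃ t : ℕ, i ∈ missing l σ M →
      (1 ≤ t ∧ t ≤ p i - 1) ∧ (⟨σ i, α (i - 1) ^ t⟩ : Hol N) ∈ M := fun i => by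
    by_cases hi : i ∈ missing l σ M
    · rw [mem_missing] at hi
      obtain ⟨j, -, rfl, -, t, ht⟩ := h.exists_mk_mem hM hi.1 hi.2
      exact ⟨t, fun _ => ht⟩
    · exact ⟨0, fun hi' => (hi hi').elim⟩
  choose t ht using hex
  refine ⟨t, fun i hi => (ht i hi).1, ?_⟩
  have hJ : J l σ α (missing l σ M) t ≤ M := by
    refine (Subgroup.closure_le _).2 ?_
    rintro g (⟨j, hj, rfl⟩ | ⟨i, hi, rfl⟩)
    · rw [Finset.mem_sdiff, mem_missing, not_and, not_not] at hj
      exact hj.2 hj.1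
    · exact (ht i hi).2
  refine le_antisymm (fun g hg => ?_) (sup_le hJ (Subgroup.map_comap_le _ _))
  -- `J` is transitive, so `g` agrees with an element of `J` up to a factor in `M ∩ Aut N`.
  obtain ⟨k, hk, hkg⟩ := h.exists_mem_J hI t g.left
  have h1 : (⟨g.left, k.right⟩ : Hol N) ∈ J l σ α (missing l σ M) t := by
    rw [← hkg]; exact hk
  have h2 := inr_inv_mul_mem (hJ h1) hg
  have h3 : (SemidirectProduct.inr (k.right⁻¹ * g.right) : Hol N) ∈
      JA l σ α (missing l σ M) t (M.comap SemidirectProduct.inr) :=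
    (le_sup_right : inHol _ ≤ _) (Subgroup.mem_map_of_mem _ h2)
  have h4 : g = ⟨g.left, k.right⟩ * SemidirectProduct.inr (k.right⁻¹ * g.right) := by
    change g = (⟨g.left, k.right⟩ * ⟨1, k.right⁻¹ * g.right⟩ : Hol N)
    rw [mk_mul_mk, map_one, mul_one, mul_inv_cancel_left]
  rw [h4]
  exact Subgroup.mul_mem _ (J_le_JA h1) h3

end Classification

end IsSystem

namespace IsSystem

variable {N : Type*} [CommGroup N] [IsCyclic N] {l : ℕ} {p : ℕ → ℕ} {x s : ℕ}
  {σ : ℕ → N} {α β : ℕ → MulAut N} {M M' : Subgroup (Hol N)}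

/-! ### Recovering `I` and `A` from the abstract group. -/

section Isomorphism

/-- A central element commutes with, hence fixes, each `σ j` in `M`; the other `σ j` are fixed by
all of `M`. Commutators die in the abelian group `Aut N`. -/
theorem center_sup_commutator_le_ker (h : IsSystem l p x s σ α β)
    (hM : MulAction.IsPretransitive M N) :
    Subgroup.center M ⊔ commutator M ≤
      (SemidirectProduct.rightHom.comp M.subtype : M →* MulAut N).ker := by
  refine sup_le (fun g hg => ?_) ?_
  · refine h.aut_ext fun j hj => ?_
    change (g : Hol N).right (σ j) = σ j
    by_cases hjM : (SemidirectProduct.inl (σ j) : Hol N) ∈ M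
    · have h1 := congrArg (fun m : M => (m : Hol N).left)
        (Subgroup.mem_center_iff.1 hg ⟨_, hjM⟩)
      change σ j * (g : Hol N).left = (g : Hol N).left * (g : Hol N).right (σ j) at h1
      rw [mul_comm, mul_right_inj] at h1
      exact h1.symm
    · exact h.right_apply_of_inl_notMem hM hj hjM g.2
  · rw [commutator_def, Subgroup.commutator_le]
    intro g _ k _
    rw [MonoidHom.mem_ker, map_commutatorElement, commutatorElement_eq_one_iff_mul_comm]
    exact aut_mul_comm _ _

open scoped commutatorElement in
/-- The translations in a transitive subgroup form its center times its commutator subgroup. -/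
theorem center_sup_commutator (h : IsSystem l p x s σ α β) (hM : MulAction.IsPretransitive M N) :
    Subgroup.center M ⊔ commutator M =
      (SemidirectProduct.rightHom.comp M.subtype : M →* MulAut N).ker := by
  refine le_antisymm (h.center_sup_commutator_le_ker hM) fun g hg => ?_
  have key : M.comap SemidirectProduct.inl ≤
      ((Subgroup.center M ⊔ commutator M).map M.subtype).comap SemidirectProduct.inl := by
    refine h.le_of_sigma_mem fun j hj hjM => ?_
    rw [Subgroup.mem_comap] at hjM
    suffices hs : (⟨_, hjM⟩ : M) ∈ Subgroup.center M ⊔ commutator M from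
      Subgroup.mem_map_of_mem M.subtype hs
    -- Either `σ j` is central in `M`, or some commutator with it is nontrivial and generates `⟨σ
    -- j⟩`.
    by_cases hfix : ∀ k ∈ M, k.right (σ j) = σ j
    · refine (le_sup_left : _ ≤ Subgroup.center M ⊔ commutator M) ?_
      refine Subgroup.mem_center_iff.2 fun k => Subtype.ext (SemidirectProduct.ext ?_ ?_)
      · change (k : Hol N).left * (k : Hol N).right (σ j) = σ j * (k : Hol N).left
        rw [hfix k k.2, mul_comm]
      · change (k : Hol N).right * 1 = 1 * (k : Hol N).right
        rw [mul_one, one_mul]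
    · push Not at hfix
      obtain ⟨k, hk, hkj⟩ := hfix
      refine (le_sup_right : _ ≤ Subgroup.center M ⊔ commutator M) ?_
      have hτ : k.right (σ j) / σ j ∈ Subgroup.zpowers (σ j) :=
        Subgroup.div_mem _ (aut_apply_mem_zpowers _ _) (Subgroup.mem_zpowers _)
      obtain ⟨z, hz⟩ := Subgroup.mem_zpowers_iff.1 (mem_zpowers_of_prime_orderOf
        (h.prime_orderOf hj) hτ fun h1 => hkj (div_eq_one.1 h1))
      have hc : ((⁅(⟨k, hk⟩ : M), ⟨_, hjM⟩⁆ : M) : Hol N) =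
          SemidirectProduct.inl (k.right (σ j) / σ j) := by
        change k * SemidirectProduct.inl (σ j) * k⁻¹ * (SemidirectProduct.inl (σ j))⁻¹ = _
        rw [mul_inv_eq_iff_eq_mul, mul_inv_eq_iff_eq_mul]
        refine SemidirectProduct.ext ?_ ?_
        · change k.left * k.right (σ j) = k.right (σ j) / σ j * σ j * k.left
          rw [div_mul_cancel, mul_comm]
        · change k.right * 1 = 1 * 1 * k.right
          rw [mul_one, one_mul, one_mul]
      have he : (⟨_, hjM⟩ : M) = ⁅(⟨k, hk⟩ : M), ⟨_, hjM⟩⁆ ^ z := by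
        refine Subtype.ext ?_
        rw [Subgroup.coe_zpow, hc, ← map_zpow, hz]
      rw [he, commutator_def]
      exact Subgroup.zpow_mem _ (Subgroup.commutator_mem_commutator (Subgroup.mem_top _)
        (Subgroup.mem_top _)) z
  have hg' : (g : Hol N) = SemidirectProduct.inl (g : Hol N).left := SemidirectProduct.ext rfl hg
  have h1 : (g : Hol N).left ∈ M.comap SemidirectProduct.inl := by
    rw [Subgroup.mem_comap, ← hg']
    exact g.2
  have h2 := key h1
  rw [Subgroup.mem_comap, ← hg'] at h2
  obtain ⟨k, hk, hkg⟩ := Subgroup.mem_map.1 h2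
  rwa [← Subtype.ext hkg]

/-- An isomorphism of transitive subgroups maps translations to translations. -/
theorem right_map_eq_one (h : IsSystem l p x s σ α β) (hM : MulAction.IsPretransitive M N)
    (hM' : MulAction.IsPretransitive M' N) (e : M ≃* M') {g : M} (hg : (g : Hol N).right = 1) :
    (e g : Hol N).right = 1 := by
  have h1 : g ∈ Subgroup.center M ⊔ commutator M := by
    rw [h.center_sup_commutator hM]; exact hg
  suffices hle : Subgroup.center M ⊔ commutator M ≤
      (Subgroup.center M' ⊔ commutator M').comap e.toMonoidHom by
    have h2 := hle h1
    rw [Subgroup.mem_comap, h.center_sup_commutator hM'] at h2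
    exact h2
  refine sup_le (fun z hz => ?_) ?_
  · refine (le_sup_left : _ ≤ Subgroup.center M' ⊔ commutator M') ?_
    refine Subgroup.mem_center_iff.2 fun k => ?_
    obtain ⟨k, rfl⟩ := e.surjective k
    change e k * e z = e z * e k
    rw [← map_mul, ← map_mul, Subgroup.mem_center_iff.1 hz k]
  · rw [← Subgroup.map_le_iff_le_comap, commutator_def, Subgroup.map_commutator]
    exact (Subgroup.commutator_mono le_top le_top).trans le_sup_right

/-- By injectivity of `e`, the order of `ν` kills `σ j`, and cyclicity of `N` gives `σ j ∈ ⟨ν⟩`. -/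
theorem exists_map_inl (h : IsSystem l p x s σ α β) (hM : MulAction.IsPretransitive M N)
    (hM' : MulAction.IsPretransitive M' N) (e : M ≃* M') {j : ℕ}
    (hjM : (SemidirectProduct.inl (σ j) : Hol N) ∈ M) :
    ∃ ν : N, (e ⟨_, hjM⟩ : Hol N) = SemidirectProduct.inl ν ∧ σ j ∈ Subgroup.zpowers ν := by
  have := h.finite
  have h1 : (e ⟨_, hjM⟩ : Hol N).right = 1 := h.right_map_eq_one hM hM' e rfl
  refine ⟨(e ⟨_, hjM⟩ : Hol N).left, SemidirectProduct.ext rfl h1, ?_⟩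
  refine mem_zpowers_of_pow_orderOf_eq_one ?_
  have h2 : (e ⟨_, hjM⟩ : Hol N) = SemidirectProduct.inl (e ⟨_, hjM⟩ : Hol N).left :=
    SemidirectProduct.ext rfl h1
  have h3 : e ⟨_, hjM⟩ ^ orderOf (e ⟨_, hjM⟩ : Hol N).left = 1 := by
    refine Subtype.ext ?_
    rw [Subgroup.coe_pow, h2, SemidirectProduct.left_inl, ← map_pow, pow_orderOf_eq_one, map_one]
    rfl
  rw [← map_pow] at h3
  have h4 := congrArg (fun m : M => (m : Hol N)) ((map_eq_one_iff e e.injective).1 h3)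
  simp only [Subgroup.coe_pow, Subgroup.coe_one] at h4
  rw [← map_pow] at h4
  exact SemidirectProduct.inl_injective (h4.trans (map_one _).symm)

theorem inl_sigma_mem_of_mulEquiv (h : IsSystem l p x s σ α β)
    (hM : MulAction.IsPretransitive M N) (hM' : MulAction.IsPretransitive M' N) (e : M ≃* M')
    {j : ℕ} (hjM : (SemidirectProduct.inl (σ j) : Hol N) ∈ M) :
    (SemidirectProduct.inl (σ j) : Hol N) ∈ M' := by
  obtain ⟨ν, hν, hσ⟩ := h.exists_map_inl hM hM' e hjM
  have h1 : ν ∈ M'.comap SemidirectProduct.inl := by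
    rw [Subgroup.mem_comap, ← hν]
    exact (e _).2
  exact Subgroup.zpowers_le.2 h1 hσ

/-- An isomorphism of transitive subgroups preserves the automorphism parts. -/
theorem right_map (h : IsSystem l p x s σ α β) (hM : MulAction.IsPretransitive M N)
    (hM' : MulAction.IsPretransitive M' N) (e : M ≃* M') (g : M) :
    (e g : Hol N).right = (g : Hol N).right := by
  refine h.aut_ext fun j hj => ?_
  by_cases hjM : (SemidirectProduct.inl (σ j) : Hol N) ∈ M
  · obtain ⟨ν, hν, hσ⟩ := h.exists_map_inl hM hM' e hjM
    obtain ⟨k, hk⟩ := Subgroup.mem_zpowers_iff.1 (aut_apply_mem_zpowers (g : Hol N).right (σ j))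
    -- This relation encodes the action of `g` on `σ j`. Its image under `e` says that `e g` raises
    -- `ν` to the power `k`, hence also `σ j`, a power of `ν`.
    have h1 : g * ⟨_, hjM⟩ = ⟨_, hjM⟩ ^ k * g := by
      refine Subtype.ext ?_
      change (g : Hol N) * SemidirectProduct.inl (σ j) = ((⟨_, hjM⟩ ^ k : M) : Hol N) * (g : Hol N)
      rw [Subgroup.coe_zpow, ← map_zpow, hk]
      refine SemidirectProduct.ext ?_ ?_
      · exact mul_comm _ _
      · change (g : Hol N).right * 1 = 1 * (g : Hol N).right
        rw [mul_one, one_mul]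
    have h2 := congrArg (fun m : M' => (m : Hol N).left) (congrArg e h1)
    simp only [map_mul, map_zpow, Subgroup.coe_mul, Subgroup.coe_zpow, hν] at h2
    rw [← map_zpow] at h2
    change (e g : Hol N).left * (e g : Hol N).right ν = ν ^ k * (e g : Hol N).left at h2
    rw [mul_comm, mul_left_inj] at h2
    obtain ⟨z, hz⟩ := Subgroup.mem_zpowers_iff.1 hσ
    rw [← hk, ← hz, map_zpow, h2, ← zpow_mul, ← zpow_mul, mul_comm]
  · have hjM' : (SemidirectProduct.inl (σ j) : Hol N) ∉ M' := fun hj' =>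
      hjM (h.inl_sigma_mem_of_mulEquiv hM' hM e.symm hj')
    rw [h.right_apply_of_inl_notMem hM hj hjM g.2,
      h.right_apply_of_inl_notMem hM' hj hjM' (e g).2]

variable {I I' : Finset ℕ} {A A' : Subgroup (MulAut N)} {t t' : ℕ → ℕ}

/-- The image of `γ ∈ A` has automorphism part `γ`, which lies in `ψ ν * A'` for some `ν`. So `ψ ν ∈
A_I`, of order prime to the `p i` with `i ∈ I`; but the product of these primes kills the image of
`ψ`. Hence `ψ ν = 1` and `γ ∈ A'`. -/
theorem le_of_mulEquiv (h : IsSystem l p x s σ α β) (hI : IsIndexSet l I)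
    (hA : A ≤ AI l α β I) (hA' : A' ≤ AI l α β I)
    (e : JA l σ α I t A ≃* JA l σ α I t' A') : A ≤ A' := by
  intro γ hγ
  have h1 : (SemidirectProduct.inr γ : Hol N) ∈ JA l σ α I t A := (h.inr_mem_JA hI hA).2 hγ
  obtain ⟨ψ, hψI, hψ⟩ := h.exists_twist hI t'
  have h2 := (h.mem_JA hI hA' hψI hψ (e ⟨_, h1⟩).2).2
  rw [h.right_map (h.isPretransitive_JA hI) (h.isPretransitive_JA hI) e,
    SemidirectProduct.right_inr] at h2
  generalize ((e ⟨_, h1⟩ : JA l σ α I t' A') : Hol N).left = ν at h2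
  have h3 : ψ ν ∈ AI l α β I := by
    have h4 := Subgroup.mul_mem _ (hA hγ) (Subgroup.inv_mem _ (hA' h2))
    rwa [mul_inv_rev, mul_inv_cancel_left, inv_inv] at h4
  have h5 : (orderOf (ψ ν)).Coprime (∏ i ∈ I, p i) :=
    Nat.Coprime.prod_right fun i hi => h.coprime_orderOf_of_mem_AI hi (hI.mem_Icc hi) h3
  have h6 : ψ.comp (powMonoidHom (∏ i ∈ I, p i)) = 1 := by
    refine h.hom_ext fun j hj => ?_
    change ψ (σ j ^ ∏ i ∈ I, p i) = 1
    by_cases hjI : j ∈ I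
    · obtain ⟨c, hc⟩ := Finset.dvd_prod_of_mem p hjI
      rw [hc, pow_mul, h.sigma_pow hj, one_pow, map_one]
    · rw [map_pow, hψ j (Finset.mem_sdiff.2 ⟨hj, hjI⟩), one_pow]
  have h7 : ψ ν ^ (∏ i ∈ I, p i) = 1 := by
    rw [← map_pow]
    exact DFunLike.congr_fun h6 ν
  rwa [eq_one_of_pow_eq_one_of_coprime (pow_orderOf_eq_one _) h7 h5, inv_one, one_mul] at h2

theorem eq_of_mulEquiv (h : IsSystem l p x s σ α β) (hI : IsIndexSet l I)
    (hA : A ≤ AI l α β I) (hI' : IsIndexSet l I') (hA' : A' ≤ AI l α β I')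
    (hM : M ∈ family l p σ α I A) (hM' : M' ∈ family l p σ α I' A') (e : M ≃* M') :
    I = I' ∧ A = A' := by
  obtain ⟨t, ht, rfl⟩ := hM
  obtain ⟨t', ht', rfl⟩ := hM'
  have hT := h.isPretransitive_JA (t := t) (A := A) hI
  have hT' := h.isPretransitive_JA (t := t') (A := A') hI'
  -- `I` consists of the indices of the missing `σ j`, which isomorphisms preserve.
  obtain rfl : I = I' := by
    ext j
    refine ⟨fun hj => ?_, fun hj => ?_⟩
    · by_contra hj'
      have hjl := hI.mem_Icc hj
      exact (h.inl_sigma_mem_JA hI hA ht hjl).1 (h.inl_sigma_mem_of_mulEquiv hT' hT e.symm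
        ((h.inl_sigma_mem_JA hI' hA' ht' hjl).2 hj')) hj
    · by_contra hj'
      have hjl := hI'.mem_Icc hj
      exact (h.inl_sigma_mem_JA hI' hA' ht' hjl).1 (h.inl_sigma_mem_of_mulEquiv hT hT' e
        ((h.inl_sigma_mem_JA hI hA ht hjl).2 hj')) hj
  exact ⟨rfl, le_antisymm (h.le_of_mulEquiv hI hA hA' e) (h.le_of_mulEquiv hI hA' hA e.symm)⟩

end Isomorphism

end IsSystem

end Cunningham

theorem mainTheorem4 {N : Type*} [Group N] [IsCyclic N] (l : ℕ) (hl : 1 ≤ l) (p : ℕ → ℕ)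
    (hp : Cunningham.IsCunninghamChain l p) (hN : Nat.card N = ∏ i ∈ Finset.Icc 1 l, p i)
    (x s : ℕ) (σ : ℕ → N) (α β : ℕ → MulAut N)
    (hgen : Cunningham.IsGenerators l p x s σ α β) :
    -- for fixed `I` and `A` there are `∏ (p i - 1)` groups `J_{I,t} ⋊ A`; they are transitive and
    -- isomorphic to each other as permutation groups
    (∀ I : Finset ℕ, Cunningham.IsIndexSet l I →
      ∀ A : Subgroup (MulAut N), A ≤ Cunningham.AI l α β I →
        (∀ t : ℕ → ℕ, Cunningham.IsExponent p I t →
          Cunningham.inHol A ≤ Subgroup.normalizer (Cunningham.J l σ α I t : Set (Cunningham.Hol N)) ∧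
          Cunningham.J l σ α I t ⊓ Cunningham.inHol A = ⊥ ∧
          MulAction.IsPretransitive (Cunningham.JA l σ α I t A) N) ∧
        (Cunningham.family l p σ α I A).ncard = ∏ i ∈ I, (p i - 1) ∧
        ∀ M ∈ Cunningham.family l p σ α I A, ∀ M' ∈ Cunningham.family l p σ α I A,
          Cunningham.PermIsomorphic M M') ∧
    -- abstractly isomorphic transitive subgroups belong to the same family
    (∀ M M' : Subgroup (Cunningham.Hol N),
      MulAction.IsPretransitive M N → MulAction.IsPretransitive M' N → Nonempty (M ≃* M') →
        ∃ (I : Finset ℕ) (A : Subgroup (MulAut N)),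
          Cunningham.IsIndexSet l I ∧ A ≤ Cunningham.AI l α β I ∧
          M ∈ Cunningham.family l p σ α I A ∧ M' ∈ Cunningham.family l p σ α I A) ∧
    -- groups from the families of different pairs `(I, A)` are not isomorphic, even abstractly
    (∀ (I I' : Finset ℕ) (A A' : Subgroup (MulAut N)),
      Cunningham.IsIndexSet l I → A ≤ Cunningham.AI l α β I →
      Cunningham.IsIndexSet l I' → A' ≤ Cunningham.AI l α β I' →
      ∀ M ∈ Cunningham.family l p σ α I A, ∀ M' ∈ Cunningham.family l p σ α I' A',
        Nonempty (M ≃* M') → I = I' ∧ A = A') := by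

  let _ : CommGroup N := IsCyclic.commGroup
  have h : Cunningham.IsSystem l p x s σ α β := { hgen with chain := hp, card_eq := hN }
  refine ⟨fun I hI A hA => ⟨fun t _ => ⟨h.inHol_le_normalizer hI hA, h.J_inf_inHol hI,
    h.isPretransitive_JA hI⟩, h.ncard_family hI hA, fun M hM M' hM' =>
      h.permIsomorphic_of_mem_family hI hM hM'⟩, fun M M' hM hM' ⟨e⟩ => ?_,
    fun I I' A A' hI hA hI' hA' M hM M' hM' ⟨e⟩ => h.eq_of_mulEquiv hI hA hI' hA' hM hM' e⟩
  obtain ⟨I, A, hI, hA, hMI⟩ := h.exists_mem_family hM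
  obtain ⟨I', A', hI', hA', hMI'⟩ := h.exists_mem_family hM'
  obtain ⟨rfl, rfl⟩ := h.eq_of_mulEquiv hI hA hI' hA' hMI hMI' e
  exact ⟨I, A, hI, hA, hMI, hMI'⟩
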